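/- Conventions. All graphs are finite and simple. Let $G$ be a group acting faithfully by automorphisms on a connected graph $\Gamma=(V,E)$. A 2-arc is a triple $(\alpha,\beta,\gamma)$ with $\{\alpha,\beta\},\{\beta,\gamma\}\in E$ and $\alpha\neq\gamma$, and $\Gamma$ is $(G,2)$-arc-transitive if $G$ is transitive on the set of 2-arcs. For an edge $\{\alpha_1,\alpha_2\}$ put $G^*=\langle G_{\alpha_1},G_{\alpha_2}\rangle$ and $M=\mathrm{soc}(G^*)$. A $(G,2)$-arc-transitive graph $\Gamma$ is of PA type if $G^*$ is faithful and quasiprimitive on each of its orbits on $V$, $M$ is the unique minimal normal subgroup of $G^*$, $M=T_1\times\cdots\times T_n$ with $n\ge 2$ and isomorphic nonabelian simple groups $T_i$, and for every $\alpha\in V$ the projections $R_i\le T_i$ of $M_\alpha$ are isomorphic to each other and satisfy $1\neq R_i<T_i$. The PA type is non-diagonal if not all of the projections $M_\alpha\to R_i$ are injective. For $H\le G$ and a $2$-element $g\in G\setminus H$ with $g^2\in H$, the coset graph $\mathrm{Cos}(G,H,g)$ has as vertices the cosets of $H$ in $G$; in terms of left cosets, $xH$ and $yH$ are adjacent if and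 only if $x^{-1}y\in HgH$. Theorem. Let $q\ge 3$ be a prime power such that $q+1$ has at most two distinct prime divisors, and either $q$ is even or $q\equiv -1\pmod 4$. Then there are connected 2-arc-transitive graphs of valency $q^2$ of non-diagonal PA type. More precisely, for a group $T$ let $(\ast)_T$ be the following assertion: there exist a finite group $G$ with $\mathrm{soc}(G)\cong T^{q+1}$, a subgroup $H\cong\mathrm{AGL}_1(q^2)$ of $G$, an element $\theta\in H$ of order $q^2-1$ with $G=\mathrm{soc}(G)\langle\theta\rangle$, and a $2$-element $g\in G\setminus H$ with $g^2\in H$, such that the coset graph $\mathrm{Cos}(G,H,g)$ is connected, $(G,2)$-arc-transitive, of valency $q^2$ and of non-diagonal PA type with $\mathrm{soc}(G^*)\cong T^{q+1}$. Then: 1. $(\ast)_T$ holds for some (nonabelian simple) group $T$; 2. if $q\ne 3$, then $(\ast)_T$ holds for $T=\mathrm{PSL}_2(q)$; 3. if $q\neq 3$ is a prime, then $(\ast)_T$ holds for $T=\mathrm{A}_q$. -/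

import Mathlib

/-- `(a, b, c)` is a `2`-arc of `Γ`. -/
def IsTwoArc {V : Type*} (Γ : SimpleGraph V) (a b c : V) : Prop :=
  Γ.Adj a b ∧ Γ.Adj b c ∧ a ≠ c

/-- `Γ` is `(G,2)`-arc-transitive. The group `G` is identified with a subgroup of `Aut Γ`, that is,
it acts faithfully on the vertices and preserves adjacency, and it is transitive on the `2`-arcs. -/
structure IsTwoArcTransitive (G : Type*) [Group G] {V : Type*} [MulAction G V]
    (Γ : SimpleGraph V) : Prop where
  faithful : FaithfulSMul G V
  adj_iff : ∀ (g : G) (a b : V), Γ.Adj (g • a) (g • b) ↔ Γ.Adj a b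
  transitive : ∀ a b c a' b' c' : V, IsTwoArc Γ a b c → IsTwoArc Γ a' b' c' →
    ∃ g : G, g • a = a' ∧ g • b = b' ∧ g • c = c'

/-- `N` is a minimal normal subgroup of `K`. -/
def IsMinimalNormal {K : Type*} [Group K] (N : Subgroup K) : Prop :=
  Minimal (fun L : Subgroup K => L.Normal ∧ L ≠ ⊥) N

/-- The socle: the subgroup generated by all minimal normal subgroups. -/
def socle (K : Type*) [Group K] : Subgroup K :=
  sSup {N : Subgroup K | IsMinimalNormal N}

/-- The group `G* = ⟨G_a, G_b⟩`, used for an edge `{a, b}`. -/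
def edgeGroup (G : Type*) [Group G] {V : Type*} [MulAction G V] (a b : V) : Subgroup G :=
  MulAction.stabilizer G a ⊔ MulAction.stabilizer G b

/-- For `φ : M ≃* T^n`, the projection of the point stabilizer `M_α` to the `i`-th factor. -/
def stabProj {K : Type*} [Group K] {V : Type*} [MulAction K V] {T : Type*} [Group T] {n : ℕ}
    {M : Subgroup K} (φ : M ≃* (Fin n → T)) (α : V) (i : Fin n) :
    MulAction.stabilizer M α →* T :=
  ((Pi.evalMonoidHom (fun _ : Fin n => T) i).comp φ.toMonoidHom).comp
    (MulAction.stabilizer M α).subtype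

/-- `K` is a quasiprimitive permutation group on each of its orbits on `V`, and it is of product
action type: its socle `M` is its unique minimal normal subgroup (equivalently, the socle itself
is a minimal normal subgroup), `φ` identifies `M` with `T^n` for a nonabelian simple group `T` and
`n ≥ 2`, and for each point `α` the images `R_i` of `M_α` in the factors are isomorphic
nontrivial proper subgroups (so that `M_α` is a subdirect product of `R_1 × ⋯ × R_n`). -/
structure IsProductAction (K : Type*) [Group K] (V : Type*) [MulAction K V] {T : Type*} [Group T]
    {n : ℕ} (φ : socle K ≃* (Fin n → T)) : Prop where
  faithful : ∀ v : V, FaithfulSMul K (MulAction.orbit K v)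
  quasiprimitive : ∀ v : V, MulAction.IsQuasiPreprimitive K (MulAction.orbit K v)
  minimal : IsMinimalNormal (socle K)
  simple : IsSimpleGroup T
  nonabelian : ∃ x y : T, x * y ≠ y * x
  two_le : 2 ≤ n
  ne_bot : ∀ (α : V) (i : Fin n), (stabProj φ α i).range ≠ ⊥
  ne_top : ∀ (α : V) (i : Fin n), (stabProj φ α i).range ≠ ⊤
  iso : ∀ (α : V) (i j : Fin n),
    Nonempty ((stabProj φ α i).range ≃* (stabProj φ α j).range)

/-- The `(G,2)`-arc-transitive graph `Γ` is of non-diagonal PA type with `soc(G*) ≅ T^n`: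
the group `G*` is of product action type, and not all of the projections
`M_α → R_i` are injective. -/
def IsNonDiagonalPA (G : Type*) [Group G] {V : Type*} [MulAction G V] (Γ : SimpleGraph V)
    (n : ℕ) (T : Type*) [Group T] : Prop :=
  ∀ a b : V, Γ.Adj a b → ∃ φ : socle (edgeGroup G a b) ≃* (Fin n → T),
    IsProductAction (edgeGroup G a b) V φ ∧
      ∀ α : V, ¬ ∀ i : Fin n, Function.Injective (stabProj φ α i)

/-- `Γ` is the coset graph `Cos(G, H, g)` (with left cosets), where `g` is a `2`-element of `G`
outside `H` whose square is in `H`. -/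
structure IsCosetGraph {G : Type*} [Group G] (H : Subgroup G) (g : G) (Γ : SimpleGraph (G ⧸ H)) :
    Prop where
  two_element : ∃ k : ℕ, orderOf g = 2 ^ k
  notMem : g ∉ H
  sq_mem : g ^ 2 ∈ H
  adj_iff : ∀ x y : G, Γ.Adj (x : G ⧸ H) (y : G ⧸ H) ↔
    x⁻¹ * y ∈ DoubleCoset.doubleCoset g (H : Set G) (H : Set G)

/-- There is a connected `(G,2)`-arc-transitive graph `Γ = Cos(G, H, g)` of valency `q^2` and of
non-diagonal PA type with `soc(G*) ≅ T^(q+1)`, for some finite group `G = T^(q+1)⟨θ⟩`, where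
`T^(q+1)` is the socle of `G`, and some vertex stabilizer `H ≅ AGL_1(q^2)`
that contains `θ`, an element of order `q^2 - 1`. -/
def ExistsNonDiagonalPAGraph (q : ℕ) (T : Type) [Group T] : Prop :=
  ∃ (G : Type) (_ : Group G) (_ : Finite G) (H : Subgroup G) (g θ : G) (Γ : SimpleGraph (G ⧸ H)),
    IsCosetGraph H g Γ ∧
    Γ.Connected ∧
    (∀ v, (Γ.neighborSet v).ncard = q ^ 2) ∧
    IsTwoArcTransitive G Γ ∧
    IsNonDiagonalPA G Γ (q + 1) T ∧
    Nonempty (socle G ≃* (Fin (q + 1) → T)) ∧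
    socle G ⊔ Subgroup.zpowers θ = ⊤ ∧
    θ ∈ H ∧ orderOf θ = q ^ 2 - 1 ∧
    ∃ (L : Type) (_ : Field L), Nat.card L = q ^ 2 ∧ Nonempty (H ≃* (L ≃ᵃ[L] L))

/-! Let F and L be the fields of orders q and q², and let w generate Lˣ. The norm w^(q+1) generates
Fˣ. Under the condition on q it has the form -u² with u in Fˣ: in even characteristic every element
is a square, and for q ≡ 3 mod 4 both -1 and a generator of Fˣ are nonsquares. So μ = w/u satisfies
μ^(q+1) = -1. For a nonzero functional f the maps ℓ_i(b) = f(μ^i b), 0 ≤ i ≤ q, have pairwise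
distinct kernels, and ℓ_i(wb) = ±u ℓ_{i+1}(b) with indices mod q+1 and the minus sign only at i = q.

Suppose T has a subgroup τ(F), an action δ of Fˣ on T extending multiplication on τ(F), and an
element s with s² = 1 that inverts δ, such that τ(F) and its conjugate by s generate T
(`FactorData`). Then b ↦ (τ(ℓ_i b))_i embeds L in P = T^(q+1), and the coordinate shift S twisted by
the multipliers ±u induces multiplication by w on L. Adjoin to P an element θ inducing S, and put G
= P⟨θ⟩, H = L⟨θ⟩ ≅ AGL₁(q²), g = (s, …, s).

Conjugation by g inverts the multipliers of S. Since S^(q+1) is δ(-u²) in every coordinate and -u²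
generates Fˣ, the result is again a power of S, so g normalizes ⟨θ⟩. Hence L is transitive on the q²
neighbours of the base vertex, while ⟨θ⟩ fixes one neighbour and is transitive on the others: this
is 2-arc-transitivity. The group ⟨L, L^g⟩ projects onto every factor and separates the coordinates,
so it is P; connectedness, G* = G and the valency follow, as the solvable group H cannot contain P.
The kernels of the ℓ_i are nonzero, so the projections of the vertex stabilizers in P are not
injective.

It remains to give factor data for PSL₂(q), for A_q, and for A₅ when q = 3. -/

/-! ### Powers of a nonabelian simple group and socles -/

section SimplePower

variable {T : Type*} [Group T] [IsSimpleGroup T]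

lemma exists_commutator_ne_one (hT : ∃ x y : T, x * y ≠ y * x) {x : T} (hx : x ≠ 1) :
    ∃ t : T, x * t * x⁻¹ * t⁻¹ ≠ 1 := by
  by_contra! h
  have hc : x ∈ Subgroup.center T := by
    rw [Subgroup.mem_center_iff]
    intro t
    have := h t
    rw [mul_inv_eq_one, mul_inv_eq_iff_eq_mul] at this
    exact this.symm
  rcases (inferInstance : (Subgroup.center T).Normal).eq_bot_or_eq_top with h0 | h0
  · rw [h0, Subgroup.mem_bot] at hc
    exact hx hc
  · obtain ⟨a, b, hab⟩ := hT
    have : b ∈ Subgroup.center T := h0 ▸ Subgroup.mem_top b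
    exact hab (Subgroup.mem_center_iff.mp this a)

variable {ι : Type*} [DecidableEq ι]

/-- A subdirect subgroup of a finite power of a nonabelian simple group that separates any two
coordinates is the whole power. -/
lemma eq_top_of_subdirect_of_separating [Finite ι] (hT : ∃ x y : T, x * y ≠ y * x)
    (L : Subgroup (ι → T)) (hsurj : ∀ (i : ι) (t : T), ∃ x ∈ L, x i = t)
    (hsep : ∀ i j : ι, i ≠ j → ∃ x ∈ L, x i = 1 ∧ x j ≠ 1) : L = ⊤ := by
  have key : ∀ (j : ι) (S : Finset ι), j ∉ S → ∀ t : T, ∃ x ∈ L, x j = t ∧ ∀ i ∈ S, x i = 1 := by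
    intro j S
    induction S using Finset.induction_on with
    | empty =>
      intro _ t
      obtain ⟨x, hx, hxt⟩ := hsurj j t
      exact ⟨x, hx, hxt, by simp⟩
    | insert i S _ ih =>
      intro hj
      rw [Finset.mem_insert, not_or] at hj
      let K : Subgroup T :=
        { carrier := {t | ∃ x ∈ L, x j = t ∧ ∀ k ∈ insert i S, x k = 1}
          one_mem' := ⟨1, L.one_mem, rfl, fun _ _ => rfl⟩
          mul_mem' := by
            rintro _ _ ⟨x, hx, rfl, hx'⟩ ⟨y, hy, rfl, hy'⟩
            exact ⟨x * y, L.mul_mem hx hy, rfl, fun k hk => by simp [hx' k hk, hy' k hk]⟩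
          inv_mem' := by
            rintro _ ⟨x, hx, rfl, hx'⟩
            exact ⟨x⁻¹, L.inv_mem hx, rfl, fun k hk => by simp [hx' k hk]⟩ }
      have hK : K.Normal := by
        refine ⟨?_⟩
        rintro _ ⟨x, hx, rfl, hx'⟩ t
        obtain ⟨y, hy, rfl⟩ := hsurj j t
        exact ⟨y * x * y⁻¹, L.mul_mem (L.mul_mem hy hx) (L.inv_mem hy), rfl,
          fun k hk => by simp [hx' k hk]⟩
      have hne : K ≠ ⊥ := by
        obtain ⟨x, hx, hxi, hxj⟩ := hsep i j (Ne.symm hj.1)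
        -- The commutator of x, trivial at i, with an element y trivial on S is trivial on both; y
        -- is chosen so that the commutator survives at j.
        obtain ⟨t, ht⟩ := exists_commutator_ne_one hT hxj
        obtain ⟨y, hy, rfl, hy'⟩ := ih hj.2 t
        intro hbot
        have hmem : x j * y j * (x j)⁻¹ * (y j)⁻¹ ∈ K := by
          refine ⟨x * y * x⁻¹ * y⁻¹,
            L.mul_mem (L.mul_mem (L.mul_mem hx hy) (L.inv_mem hx)) (L.inv_mem hy), rfl, ?_⟩
          intro k hk
          rcases Finset.mem_insert.mp hk with rfl | hk
          · simp [hxi]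
          · simp [hy' k hk]
        rw [hbot, Subgroup.mem_bot] at hmem
        exact ht hmem
      have htop := hK.eq_bot_or_eq_top.resolve_left hne
      intro t
      have : t ∈ K := htop ▸ Subgroup.mem_top t
      exact this
  have := Fintype.ofFinite ι
  rw [eq_top_iff]
  intro x _
  refine Subgroup.pi_mem_of_mulSingle_mem x fun j => ?_
  obtain ⟨y, hy, hyj, hy'⟩ := key j (Finset.univ.erase j) (by simp) (x j)
  convert hy
  ext k
  by_cases hk : k = j
  · subst hk; simp [hyj]
  · simp [hk, hy' k]

/-- A nontrivial normal subgroup of a power of a nonabelian simple group contains a factor. -/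
lemma exists_mulSingle_mem_of_normal (hT : ∃ x y : T, x * y ≠ y * x)
    (L : Subgroup (ι → T)) [hL : L.Normal] (hne : L ≠ ⊥) :
    ∃ j : ι, ∀ t : T, Pi.mulSingle j t ∈ L := by
  obtain ⟨x, hx, hx1⟩ := (Subgroup.ne_bot_iff_exists_ne_one).mp hne |>.elim
    fun x hx => (⟨x.1, x.2, fun h => hx (Subtype.ext h)⟩ : ∃ x : ι → T, x ∈ L ∧ x ≠ 1)
  obtain ⟨j, hj⟩ := Function.ne_iff.mp hx1
  obtain ⟨t, ht⟩ := exists_commutator_ne_one hT hj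
  refine ⟨j, ?_⟩
  have hmem : (Pi.mulSingle j (x j * t * (x j)⁻¹ * t⁻¹) : ι → T) ∈ L := by
    have h1 : x * (Pi.mulSingle j t * x⁻¹ * (Pi.mulSingle j t)⁻¹) ∈ L :=
      L.mul_mem hx (hL.conj_mem _ (L.inv_mem hx) _)
    convert h1 using 1
    ext k
    by_cases hk : k = j
    · subst hk; simp [mul_assoc]
    · simp [hk]
  have hn : (L.comap (MonoidHom.mulSingle (fun _ : ι => T) j)).Normal := inferInstance
  rcases hn.eq_bot_or_eq_top with h0 | h0
  · refine absurd ?_ ht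
    have : x j * t * (x j)⁻¹ * t⁻¹ ∈ L.comap (MonoidHom.mulSingle (fun _ : ι => T) j) := hmem
    rwa [h0, Subgroup.mem_bot] at this
  · intro t
    have : t ∈ L.comap (MonoidHom.mulSingle (fun _ : ι => T) j) := h0 ▸ Subgroup.mem_top t
    exact this

/-- If a self-centralizing normal subgroup is a finite power of a nonabelian simple group whose
factors are permuted transitively, then it lies in every nontrivial normal subgroup. -/
lemma range_le_of_normal [Finite ι] (hT : ∃ x y : T, x * y ≠ y * x) {G : Type*} [Group G]
    (ψ : (ι → T) →* G) [hnorm : ψ.range.Normal]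
    (hcent : ∀ y : G, (∀ x, y * ψ x * y⁻¹ = ψ x) → y = 1)
    (htrans : ∀ i j : ι, ∃ (y : G) (e : MulAut T),
      ∀ t, y * ψ (Pi.mulSingle i t) * y⁻¹ = ψ (Pi.mulSingle j (e t)))
    (L : Subgroup G) [hL : L.Normal] (hne : L ≠ ⊥) : ψ.range ≤ L := by
  -- Two normal subgroups with trivial intersection commute, so L would centralize the range and be
  -- trivial.
  have hne' : L.comap ψ ≠ ⊥ := by
    intro hbot
    apply hne
    rw [Subgroup.eq_bot_iff_forall]
    intro y hy
    refine hcent y fun x => ?_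
    obtain ⟨z, hz⟩ := hnorm.conj_mem (ψ x) ⟨x, rfl⟩ y
    have h1 : z * x⁻¹ ∈ L.comap ψ := by
      change ψ (z * x⁻¹) ∈ L
      rw [map_mul, map_inv, hz]
      have := L.mul_mem hy (hL.conj_mem _ (L.inv_mem hy) (ψ x))
      convert this using 1
      group
    rw [hbot, Subgroup.mem_bot, mul_inv_eq_one] at h1
    rw [← hz, h1]
  obtain ⟨i, hi⟩ := exists_mulSingle_mem_of_normal hT (L.comap ψ) hne'
  rintro _ ⟨x, rfl⟩
  change x ∈ L.comap ψ
  refine Subgroup.pi_mem_of_mulSingle_mem x fun j => ?_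
  obtain ⟨y, e, hy⟩ := htrans i j
  change ψ _ ∈ L
  have := hy (e.symm (x j))
  rw [MulEquiv.apply_symm_apply] at this
  rw [← this]
  exact hL.conj_mem _ (hi _) _

end SimplePower

lemma isMinimalNormal_of_forall_le {K : Type*} [Group K] {M : Subgroup K} (hM : M.Normal)
    (hne : M ≠ ⊥) (hle : ∀ L : Subgroup K, L.Normal → L ≠ ⊥ → M ≤ L) : IsMinimalNormal M :=
  ⟨⟨hM, hne⟩, fun L hL _ => hle L hL.1 hL.2⟩

lemma socle_eq_of_forall_le {K : Type*} [Group K] {M : Subgroup K} (hM : M.Normal)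
    (hne : M ≠ ⊥) (hle : ∀ L : Subgroup K, L.Normal → L ≠ ⊥ → M ≤ L) : socle K = M := by
  have : {N : Subgroup K | IsMinimalNormal N} = {M} := by
    ext N
    refine ⟨fun hN => ?_, fun hN => ?_⟩
    · have h1 := hle N hN.1.1 hN.1.2
      exact le_antisymm (hN.2 ⟨hM, hne⟩ h1) h1
    · rw [Set.mem_singleton_iff.mp hN]
      exact isMinimalNormal_of_forall_le hM hne hle
  rw [socle, this, sSup_singleton]

/-! ### Coset graphs of an involution -/

section CosetGraph

variable {G : Type*} [Group G]

/-- The coset graph of `G` relative to `H` and an involution `g ∉ H`. -/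
def cosetGraph (H : Subgroup G) (g : G) (hg : g ∉ H) (hg2 : g * g = 1) :
    SimpleGraph (G ⧸ H) where
  Adj a b := ∃ x y : G, a = x ∧ b = y ∧ x⁻¹ * y ∈ DoubleCoset.doubleCoset g (H : Set G) (H : Set G)
  symm := by
    refine ⟨?_⟩
    rintro _ _ ⟨x, y, rfl, rfl, h⟩
    refine ⟨y, x, rfl, rfl, ?_⟩
    rw [DoubleCoset.mem_doubleCoset] at h ⊢
    obtain ⟨h1, hh1, h2, hh2, he⟩ := h
    refine ⟨h2⁻¹, H.inv_mem hh2, h1⁻¹, H.inv_mem hh1, ?_⟩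
    have hgi : g⁻¹ = g := inv_eq_of_mul_eq_one_left hg2
    have := congrArg (·⁻¹) he
    simpa [mul_assoc, hgi] using this
  loopless := by
    refine ⟨?_⟩
    rintro _ ⟨x, y, hx, hy, h⟩
    rw [DoubleCoset.mem_doubleCoset] at h
    obtain ⟨h1, hh1, h2, hh2, he⟩ := h
    have hxy : x⁻¹ * y ∈ H := QuotientGroup.eq.mp (hx.symm.trans hy)
    apply hg
    have : g = h1⁻¹ * (x⁻¹ * y) * h2⁻¹ := by rw [he]; group
    rw [this]
    exact H.mul_mem (H.mul_mem (H.inv_mem hh1) hxy) (H.inv_mem hh2)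

variable {H : Subgroup G} {g : G} {hg : g ∉ H} {hg2 : g * g = 1}

lemma cosetGraph_adj_iff (x y : G) : (cosetGraph H g hg hg2).Adj (x : G ⧸ H) (y : G ⧸ H) ↔
    x⁻¹ * y ∈ DoubleCoset.doubleCoset g (H : Set G) (H : Set G) := by
  refine ⟨?_, fun h => ⟨x, y, rfl, rfl, h⟩⟩
  rintro ⟨x', y', hx, hy, h⟩
  rw [DoubleCoset.mem_doubleCoset] at h ⊢
  obtain ⟨h1, hh1, h2, hh2, he⟩ := h
  refine ⟨x⁻¹ * x' * h1, H.mul_mem (QuotientGroup.eq.mp hx) hh1, h2 * (y'⁻¹ * y),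
    H.mul_mem hh2 (QuotientGroup.eq.mp hy.symm), ?_⟩
  calc x⁻¹ * y = x⁻¹ * x' * (x'⁻¹ * y') * (y'⁻¹ * y) := by group
    _ = _ := by rw [he]; group

lemma cosetGraph_adj_smul_iff (z : G) (a b : G ⧸ H) :
    (cosetGraph H g hg hg2).Adj (z • a) (z • b) ↔ (cosetGraph H g hg hg2).Adj a b := by
  induction a using QuotientGroup.induction_on with | _ x
  induction b using QuotientGroup.induction_on with | _ y
  rw [MulAction.Quotient.smul_coe, MulAction.Quotient.smul_coe, smul_eq_mul, smul_eq_mul,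
    cosetGraph_adj_iff, cosetGraph_adj_iff]
  rw [show (z * x)⁻¹ * (z * y) = x⁻¹ * y by group]

lemma isCosetGraph_cosetGraph : IsCosetGraph H g (cosetGraph H g hg hg2) where
  two_element := ⟨1, (orderOf_eq_prime (p := 2) (by rw [pow_two, hg2]) (by
    rintro rfl; exact hg H.one_mem)).trans (pow_one 2).symm⟩
  notMem := hg
  sq_mem := by rw [pow_two, hg2]; exact H.one_mem
  adj_iff := cosetGraph_adj_iff

lemma cosetGraph_exists_rep_of_adj {a b : G ⧸ H} (hab : (cosetGraph H g hg hg2).Adj a b) :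
    ∃ y : G, a = (y : G ⧸ H) ∧ b = ((y * g : G) : G ⧸ H) := by
  obtain ⟨x, y, rfl, rfl, h⟩ := hab
  rw [DoubleCoset.mem_doubleCoset] at h
  obtain ⟨h1, hh1, h2, hh2, he⟩ := h
  refine ⟨x * h1, (QuotientGroup.mk_mul_of_mem x hh1).symm, ?_⟩
  rw [QuotientGroup.eq, show y⁻¹ * (x * h1 * g) = h2⁻¹ by
    rw [inv_mul_eq_iff_eq_mul.mp he]; group]
  exact H.inv_mem hh2

lemma cosetGraph_adj_mul_right (y : G) :
    (cosetGraph H g hg hg2).Adj (y : G ⧸ H) ((y * g : G) : G ⧸ H) := by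
  rw [cosetGraph_adj_iff, DoubleCoset.mem_doubleCoset]
  exact ⟨1, H.one_mem, 1, H.one_mem, by group⟩

/-- An edge has the form {yH, ygH}, and its two stabilizers are the conjugates by y of H and gHg⁻¹.
-/
lemma edgeGroup_cosetGraph_eq_top
    (hsup : ∀ K : Subgroup G, H ≤ K → (∀ h ∈ H, g * h * g⁻¹ ∈ K) → K = ⊤)
    {a b : G ⧸ H} (hab : (cosetGraph H g hg hg2).Adj a b) : edgeGroup G a b = ⊤ := by
  obtain ⟨y, rfl, rfl⟩ := cosetGraph_exists_rep_of_adj hab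
  set E := edgeGroup G (y : G ⧸ H) ((y * g : G) : G ⧸ H)
  have key : E.comap (MulAut.conj y).toMonoidHom = ⊤ := by
    apply hsup
    · intro h hh
      change y * h * y⁻¹ ∈ E
      refine Subgroup.mem_sup_left (?_ : _ • _ = _)
      rw [MulAction.Quotient.smul_coe, smul_eq_mul, inv_mul_cancel_right]
      exact QuotientGroup.mk_mul_of_mem y hh
    · intro h hh
      change y * (g * h * g⁻¹) * y⁻¹ ∈ E
      refine Subgroup.mem_sup_right (?_ : _ • _ = _)
      rw [MulAction.Quotient.smul_coe, smul_eq_mul,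
        show y * (g * h * g⁻¹) * y⁻¹ * (y * g) = y * g * h by group]
      exact QuotientGroup.mk_mul_of_mem _ hh
  rw [eq_top_iff]
  intro x _
  have : y⁻¹ * x * y ∈ E.comap (MulAut.conj y).toMonoidHom := key ▸ Subgroup.mem_top _
  have h2 : y * (y⁻¹ * x * y) * y⁻¹ ∈ E := this
  rwa [show y * (y⁻¹ * x * y) * y⁻¹ = x by group] at h2

/-- The x for which xH is reachable from H form a subgroup, because left multiplication preserves
adjacency; it contains H and g. -/
lemma cosetGraph_connected
    (hsup : ∀ K : Subgroup G, H ≤ K → (∀ h ∈ H, g * h * g⁻¹ ∈ K) → K = ⊤) :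
    (cosetGraph H g hg hg2).Connected := by
  set Γ := cosetGraph H g hg hg2
  have hmap : ∀ (z : G) (a b : G ⧸ H), Γ.Reachable a b → Γ.Reachable (z • a) (z • b) := by
    intro z a b hab
    let f : Γ →g Γ := ⟨fun v => z • v, fun h => (cosetGraph_adj_smul_iff z _ _).mpr h⟩
    exact hab.map f
  let R : Subgroup G :=
    { carrier := {x | Γ.Reachable ((1 : G) : G ⧸ H) (x : G ⧸ H)}
      one_mem' := SimpleGraph.Reachable.refl _
      mul_mem' := by
        intro x y hx hy
        have := hmap x _ _ hy
        rw [MulAction.Quotient.smul_coe, MulAction.Quotient.smul_coe, smul_eq_mul, smul_eq_mul,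
          mul_one] at this
        exact SimpleGraph.Reachable.trans hx this
      inv_mem' := by
        intro x hx
        have := hmap x⁻¹ _ _ hx
        rw [MulAction.Quotient.smul_coe, MulAction.Quotient.smul_coe, smul_eq_mul, smul_eq_mul,
          mul_one, inv_mul_cancel] at this
        exact this.symm }
  have hHR : H ≤ R := by
    intro h hh
    change Γ.Reachable _ _
    have : ((1 : G) : G ⧸ H) = (h : G ⧸ H) := by rw [QuotientGroup.eq]; simpa using hh
    rw [this]
  have hgR : g ∈ R := by
    have := cosetGraph_adj_mul_right (H := H) (hg := hg) (hg2 := hg2) 1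
    rw [one_mul] at this
    exact this.reachable
  have htop : R = ⊤ := hsup R hHR fun h hh =>
    R.mul_mem (R.mul_mem hgR (hHR hh)) (R.inv_mem hgR)
  have hall : ∀ v : G ⧸ H, Γ.Reachable ((1 : G) : G ⧸ H) v := by
    intro v
    induction v using QuotientGroup.induction_on with | _ x
    have : x ∈ R := htop ▸ Subgroup.mem_top x
    exact this
  exact (SimpleGraph.connected_iff _).mpr ⟨fun a b => (hall a).symm.trans (hall b), ⟨((1 : G) : G ⧸ H)⟩⟩

lemma zpow_mul_eq_mul_zpow_of_conj {θ : G} (hgθ : ∃ k : ℤ, g⁻¹ * θ * g = θ ^ k) (j : ℤ) :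
    ∃ k : ℤ, θ ^ j * g = g * θ ^ k := by
  obtain ⟨k, hk⟩ := hgθ
  refine ⟨k * j, ?_⟩
  rw [zpow_mul, ← hk]
  have : (g⁻¹ * θ * g) ^ j = g⁻¹ * θ ^ j * g := by
    have := conj_zpow (a := g⁻¹) (b := θ) (i := j)
    rwa [inv_inv] at this
  rw [this]; group

variable {N : Subgroup G} {θ : G}

/-- Powers of θ pass through g, so HgH = N⟨θ⟩gH = NgH. -/
lemma cosetGraph_adj_iff_exists (hNH : N ≤ H) (hθ : θ ∈ H)
    (hfac : ∀ h ∈ H, ∃ n ∈ N, ∃ k : ℤ, h = n * θ ^ k)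
    (hgθ : ∃ k : ℤ, g⁻¹ * θ * g = θ ^ k) (x : G) (b : G ⧸ H) :
    (cosetGraph H g hg hg2).Adj (x : G ⧸ H) b ↔ ∃ n ∈ N, b = ((x * n * g : G) : G ⧸ H) := by
  constructor
  · intro h
    induction b using QuotientGroup.induction_on with | _ y
    rw [cosetGraph_adj_iff, DoubleCoset.mem_doubleCoset] at h
    obtain ⟨h1, hh1, h2, hh2, he⟩ := h
    obtain ⟨n, hn, j, rfl⟩ := hfac h1 hh1
    obtain ⟨k, hk⟩ := zpow_mul_eq_mul_zpow_of_conj hgθ j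
    refine ⟨n, hn, ?_⟩
    have : y = x * n * g * (θ ^ k * h2) := by
      rw [inv_mul_eq_iff_eq_mul.mp he, mul_assoc n, hk]; group
    rw [this]
    exact QuotientGroup.mk_mul_of_mem _ (H.mul_mem (H.zpow_mem hθ k) hh2)
  · rintro ⟨n, hn, rfl⟩
    rw [cosetGraph_adj_iff, DoubleCoset.mem_doubleCoset]
    exact ⟨n, hNH hn, 1, H.one_mem, by group⟩

lemma cosetGraph_ncard_neighborSet (hNH : N ≤ H) (hθ : θ ∈ H)
    (hfac : ∀ h ∈ H, ∃ n ∈ N, ∃ k : ℤ, h = n * θ ^ k)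
    (hgθ : ∃ k : ℤ, g⁻¹ * θ * g = θ ^ k) (hsep : ∀ n ∈ N, g⁻¹ * n * g ∈ H → n = 1)
    (v : G ⧸ H) : ((cosetGraph H g hg hg2).neighborSet v).ncard = Nat.card N := by
  induction v using QuotientGroup.induction_on with | _ x
  have h1 : (cosetGraph H g hg hg2).neighborSet (x : G ⧸ H) =
      Set.range (fun n : N => ((x * n * g : G) : G ⧸ H)) := by
    ext b
    rw [SimpleGraph.mem_neighborSet, cosetGraph_adj_iff_exists hNH hθ hfac hgθ]
    constructor
    · rintro ⟨n, hn, rfl⟩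
      exact ⟨⟨n, hn⟩, rfl⟩
    · rintro ⟨n, rfl⟩
      exact ⟨n, n.2, rfl⟩
  rw [h1, ← Set.image_univ, Set.ncard_image_of_injective, Set.ncard_univ]
  rintro ⟨n, hn⟩ ⟨m, hm⟩ hnm
  have := QuotientGroup.eq.mp hnm
  rw [show (x * n * g)⁻¹ * (x * m * g) = g⁻¹ * (n⁻¹ * m) * g by group] at this
  have := hsep _ (N.mul_mem (N.inv_mem hn) hm) this
  exact Subtype.ext (inv_mul_eq_one.mp this)

/-- Every 2-arc is a translate of (gH, H, ngH) with 1 ≠ n ∈ N. Powers of θ fix H and gH, and by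
`htr` they conjugate n to any other nontrivial element of N. -/
lemma cosetGraph_isTwoArcTransitive (hNH : N ≤ H) (hθ : θ ∈ H)
    (hfac : ∀ h ∈ H, ∃ n ∈ N, ∃ k : ℤ, h = n * θ ^ k)
    (hgθ : ∃ k : ℤ, g⁻¹ * θ * g = θ ^ k)
    (htr : ∀ n ∈ N, ∀ m ∈ N, n ≠ 1 → m ≠ 1 → ∃ k : ℤ, θ ^ k * n = m * θ ^ k)
    (hcore : ∀ L : Subgroup G, L.Normal → L ≤ H → L = ⊥) :
    IsTwoArcTransitive G (cosetGraph H g hg hg2) where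
  faithful := by
    refine ⟨fun {x y} hxy => ?_⟩
    have hmem : x⁻¹ * y ∈ H.normalCore := by
      intro z
      have := hxy (z⁻¹ : G)
      rw [MulAction.Quotient.smul_coe, MulAction.Quotient.smul_coe, smul_eq_mul, smul_eq_mul,
        QuotientGroup.eq] at this
      rwa [show (x * z⁻¹)⁻¹ * (y * z⁻¹) = z * (x⁻¹ * y) * z⁻¹ by group] at this
    rw [hcore _ inferInstance H.normalCore_le, Subgroup.mem_bot] at hmem
    exact inv_mul_eq_one.mp hmem
  adj_iff := cosetGraph_adj_smul_iff
  transitive := by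
    have key : ∀ a b c : G ⧸ H, IsTwoArc (cosetGraph H g hg hg2) a b c →
        ∃ y : G, ∃ n ∈ N, n ≠ 1 ∧ a = ((y * g : G) : G ⧸ H) ∧ b = (y : G ⧸ H) ∧
          c = ((y * n * g : G) : G ⧸ H) := by
      rintro a b c ⟨hab, hbc, hac⟩
      induction b using QuotientGroup.induction_on with | _ x
      obtain ⟨n, hn, rfl⟩ := (cosetGraph_adj_iff_exists hNH hθ hfac hgθ x a).mp hab.symm
      obtain ⟨m, hm, rfl⟩ := (cosetGraph_adj_iff_exists hNH hθ hfac hgθ x c).mp hbc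
      refine ⟨x * n, n⁻¹ * m, N.mul_mem (N.inv_mem hn) hm, ?_, rfl,
        (QuotientGroup.mk_mul_of_mem x (hNH hn)).symm, ?_⟩
      · intro h
        exact hac (by rw [inv_mul_eq_one.mp h])
      · rw [show x * n * (n⁻¹ * m) * g = x * m * g by group]
    intro a b c a' b' c' h h'
    obtain ⟨y, n, hn, hn1, rfl, rfl, rfl⟩ := key a b c h
    obtain ⟨y', m, hm, hm1, rfl, rfl, rfl⟩ := key a' b' c' h'
    obtain ⟨j, hj⟩ := htr n hn m hm hn1 hm1
    obtain ⟨k, hk⟩ := zpow_mul_eq_mul_zpow_of_conj hgθ j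
    refine ⟨y' * θ ^ j * y⁻¹, ?_, ?_, ?_⟩
    · rw [MulAction.Quotient.smul_coe, smul_eq_mul,
        show y' * θ ^ j * y⁻¹ * (y * g) = y' * (θ ^ j * g) by group, hk, ← mul_assoc]
      exact QuotientGroup.mk_mul_of_mem _ (H.zpow_mem hθ k)
    · rw [MulAction.Quotient.smul_coe, smul_eq_mul, inv_mul_cancel_right]
      exact QuotientGroup.mk_mul_of_mem _ (H.zpow_mem hθ j)
    · rw [MulAction.Quotient.smul_coe, smul_eq_mul,
        show y' * θ ^ j * y⁻¹ * (y * n * g) = y' * ((θ ^ j * n) * g) by group, hj,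
        show y' * (m * θ ^ j * g) = y' * m * (θ ^ j * g) by group, hk, ← mul_assoc]
      exact QuotientGroup.mk_mul_of_mem _ (H.zpow_mem hθ k)

end CosetGraph

/-! ### Product action type on the cosets of H -/

section ProductAction

variable {T : Type*} [Group T] {n : ℕ} {G : Type*} [Group G] {H : Subgroup G}

/-- Write P for the range of `ψ`. Since G = PH, P is transitive, and so is every nontrivial normal
subgroup because it contains P. The point stabilizers in P are conjugate under P, so the conditions
on the projections need checking only at the base coset. -/
lemma exists_isProductAction_of_eq_top [IsSimpleGroup T] (hT : ∃ x y : T, x * y ≠ y * x)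
    (hn : 2 ≤ n) (ψ : (Fin n → T) →* G) (hψ : Function.Injective ψ) (hnorm : ψ.range.Normal)
    (hle : ∀ L : Subgroup G, L.Normal → L ≠ ⊥ → ψ.range ≤ L)
    (hsolv : Group.IsSolvable H) (hcore : ∀ L : Subgroup G, L.Normal → L ≤ H → L = ⊥)
    (hfac : ∀ x : G, ∃ p, ∃ h ∈ H, x = ψ p * h)
    (hbot : ∀ i, ∃ x, ψ x ∈ H ∧ x i ≠ 1)
    (hinj : ∃ i x, ψ x ∈ H ∧ x i = 1 ∧ x ≠ 1)
    (hiso : ∀ i j, ∃ y ∈ H, ∃ e : MulAut T, ∀ x x', y * ψ x * y⁻¹ = ψ x' → x' j = e (x i))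
    (K : Subgroup G) (hK : K = ⊤) :
    ∃ φ : socle K ≃* (Fin n → T), IsProductAction K (G ⧸ H) φ ∧
      ∀ α : G ⧸ H, ¬ ∀ i : Fin n, Function.Injective (stabProj φ α i) := by
  subst hK
  let χ : (Fin n → T) →* (⊤ : Subgroup G) := ψ.codRestrict ⊤ fun _ => Subgroup.mem_top _
  have hχ : Function.Injective χ := fun x y h => hψ (congrArg Subtype.val h)
  have hmemχ : ∀ z : (⊤ : Subgroup G), z ∈ χ.range ↔ (z : G) ∈ ψ.range := fun z =>
    ⟨fun ⟨x, hx⟩ => ⟨x, congrArg Subtype.val hx⟩, fun ⟨x, hx⟩ => ⟨x, Subtype.ext hx⟩⟩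
  have hχnorm : χ.range.Normal := ⟨fun z hz y => by
    rw [hmemχ] at hz ⊢
    exact hnorm.conj_mem _ hz _⟩
  obtain ⟨i₀, x₀, hx₀, hx₀i, hx₀1⟩ := hinj
  have hχbot : χ.range ≠ ⊥ := by
    intro h
    have : χ x₀ ∈ χ.range := ⟨x₀, rfl⟩
    rw [h, Subgroup.mem_bot, ← map_one χ] at this
    exact hx₀1 (hχ this)
  have hχle : ∀ L : Subgroup (⊤ : Subgroup G), L.Normal → L ≠ ⊥ → χ.range ≤ L := by
    intro L hL hL0
    have h1 : (L.map (⊤ : Subgroup G).subtype).Normal := by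
      refine ⟨?_⟩
      rintro _ ⟨z, hz, rfl⟩ y
      exact ⟨⟨y, Subgroup.mem_top y⟩ * z * ⟨y, Subgroup.mem_top y⟩⁻¹, hL.conj_mem _ hz _, rfl⟩
    have h2 : L.map (⊤ : Subgroup G).subtype ≠ ⊥ := by
      rwa [Ne, Subgroup.map_eq_bot_iff_of_injective _ (Subgroup.subtype_injective _)]
    rintro _ ⟨x, rfl⟩
    obtain ⟨z, hz, hzx⟩ := hle _ h1 h2 ⟨x, rfl⟩
    have : z = χ x := Subtype.ext hzx
    exact this ▸ hz
  have hsoc : socle (⊤ : Subgroup G) = χ.range := socle_eq_of_forall_le hχnorm hχbot hχle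
  let φ : socle (⊤ : Subgroup G) ≃* (Fin n → T) :=
    (MulEquiv.subgroupCongr hsoc).trans (MonoidHom.ofInjective hχ).symm
  have hφ : ∀ m : socle (⊤ : Subgroup G), ((m : (⊤ : Subgroup G)) : G) = ψ (φ m) := by
    intro m
    have : (MonoidHom.ofInjective hχ) (φ m) = MulEquiv.subgroupCongr hsoc m :=
      MulEquiv.apply_symm_apply _ _
    exact (congrArg (fun z : χ.range => ((z : (⊤ : Subgroup G)) : G)) this).symm
  have hφs : ∀ x, ((φ.symm x : (⊤ : Subgroup G)) : G) = ψ x := fun x => by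
    rw [hφ, MulEquiv.apply_symm_apply]
  let R : Fin n → Subgroup T := fun i => (H.comap ψ).map (Pi.evalMonoidHom (fun _ => T) i)
  have hrep : ∀ α : G ⧸ H, ∃ p, α = (ψ p : G) := by
    intro α
    induction α using QuotientGroup.induction_on with | _ x
    obtain ⟨p, h, hh, rfl⟩ := hfac x
    exact ⟨p, QuotientGroup.mk_mul_of_mem _ hh⟩
  have hstab : ∀ p x, ψ x • ((ψ p : G) : G ⧸ H) = (ψ p : G) ↔ ψ (p⁻¹ * x * p) ∈ H := by
    intro p x
    rw [MulAction.Quotient.smul_coe, smul_eq_mul, eq_comm, QuotientGroup.eq]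
    simp only [map_mul, map_inv, mul_assoc]
  have hrange : ∀ p i, (stabProj φ ((ψ p : G) : G ⧸ H) i).range =
      (R i).map (MulAut.conj (p i)).toMonoidHom := by
    intro p i
    ext t
    constructor
    · rintro ⟨⟨m, hm⟩, rfl⟩
      have hm' : ((m : (⊤ : Subgroup G)) : G) • ((ψ p : G) : G ⧸ H) = (ψ p : G) := hm
      rw [hφ, hstab] at hm'
      refine ⟨_, ⟨_, hm', rfl⟩, ?_⟩
      change p i * ((p i)⁻¹ * φ m i * p i) * (p i)⁻¹ = φ m i
      group
    · rintro ⟨_, ⟨x, hx, rfl⟩, rfl⟩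
      refine ⟨⟨φ.symm (p * x * p⁻¹), ?_⟩, ?_⟩
      · change ((φ.symm (p * x * p⁻¹) : (⊤ : Subgroup G)) : G) • ((ψ p : G) : G ⧸ H) = (ψ p : G)
        rw [hφs, hstab]
        convert! (show ψ x ∈ H from hx) using 2
        group
      · change φ (φ.symm (p * x * p⁻¹)) i = p i * x i * (p i)⁻¹
        rw [MulEquiv.apply_symm_apply]
        rfl
  have hRiso : ∀ i j, Nonempty (R i ≃* R j) := by
    intro i j
    obtain ⟨y, hy, e, he⟩ := hiso i j
    have : (R i).map e.toMonoidHom = R j := by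
      ext t
      constructor
      · rintro ⟨_, ⟨x, hx, rfl⟩, rfl⟩
        obtain ⟨x', hx'⟩ := hnorm.conj_mem (ψ x) ⟨x, rfl⟩ y
        refine ⟨x', ?_, he x x' hx'.symm⟩
        change ψ x' ∈ H
        rw [hx']
        exact H.mul_mem (H.mul_mem hy hx) (H.inv_mem hy)
      · rintro ⟨x', hx', rfl⟩
        obtain ⟨x, hx⟩ := hnorm.conj_mem (ψ x') ⟨x', rfl⟩ y⁻¹
        rw [inv_inv] at hx
        refine ⟨x i, ⟨x, ?_, rfl⟩, ?_⟩
        · change ψ x ∈ H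
          rw [hx]
          exact H.mul_mem (H.mul_mem (H.inv_mem hy) hx') hy
        · exact (he x x' (by rw [hx]; group)).symm
    exact ⟨((R i).equivMapOfInjective _ e.injective).trans (MulEquiv.subgroupCongr this)⟩
  have hKtrans : ∀ v w : G ⧸ H, ∃ p, ψ p • v = w := by
    intro v w
    obtain ⟨p, rfl⟩ := hrep v
    obtain ⟨r, rfl⟩ := hrep w
    refine ⟨r * p⁻¹, ?_⟩
    rw [MulAction.Quotient.smul_coe, smul_eq_mul, ← map_mul, inv_mul_cancel_right]
  have hfaith : ∀ z : (⊤ : Subgroup G), (∀ v : G ⧸ H, z • v = v) → z = 1 := by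
    intro z hz
    have hmem : (z : G) ∈ H.normalCore := by
      intro y
      have : ((z : G) • ((y⁻¹ : G) : G ⧸ H)) = (y⁻¹ : G) := hz (y⁻¹ : G)
      rw [MulAction.Quotient.smul_coe, smul_eq_mul, eq_comm,
        QuotientGroup.eq, inv_inv, ← mul_assoc] at this
      exact this
    rw [hcore _ inferInstance H.normalCore_le, Subgroup.mem_bot] at hmem
    exact Subtype.ext hmem
  have horb : ∀ v w : G ⧸ H, w ∈ MulAction.orbit (⊤ : Subgroup G) v := by
    intro v w
    obtain ⟨p, hp⟩ := hKtrans v w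
    exact ⟨χ p, hp⟩
  refine ⟨φ, ?_, ?_⟩
  · refine
      { faithful := fun v => ?_
        quasiprimitive := fun v => ?_
        minimal := hsoc ▸ isMinimalNormal_of_forall_le hχnorm hχbot hχle
        simple := inferInstance
        nonabelian := hT
        two_le := hn
        ne_bot := fun α i h => ?_
        ne_top := fun α i h => ?_
        iso := fun α i j => ?_ }
    · refine ⟨fun {x y} hxy => inv_mul_eq_one.mp (hfaith (x⁻¹ * y) fun w => ?_)⟩
      have := congrArg Subtype.val (hxy ⟨w, horb v w⟩)
      rw [mul_smul, inv_smul_eq_iff]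
      exact this.symm
    · refine { exists_smul_eq := ?_, isPretransitive_of_normal := ?_ }
      · rintro ⟨a, ha⟩ ⟨b, hb⟩
        obtain ⟨p, hp⟩ := hKtrans a b
        exact ⟨χ p, Subtype.ext hp⟩
      · intro L hL hfix
        have hL0 : L ≠ ⊥ := by
          rintro rfl
          apply hfix
          rw [Set.eq_univ_iff_forall]
          rintro w ⟨z, hz⟩
          rw [Subgroup.mem_bot] at hz
          subst hz
          exact one_smul _ w
        refine ⟨?_⟩
        rintro ⟨a, ha⟩ ⟨b, hb⟩
        obtain ⟨p, hp⟩ := hKtrans a b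
        exact ⟨⟨χ p, hχle L hL hL0 ⟨p, rfl⟩⟩, Subtype.ext hp⟩
    · obtain ⟨p, rfl⟩ := hrep α
      rw [hrange, Subgroup.map_eq_bot_iff_of_injective _ (MulAut.conj (p i)).injective] at h
      obtain ⟨x, hx, hxi⟩ := hbot i
      have : x i ∈ R i := ⟨x, hx, rfl⟩
      rw [h, Subgroup.mem_bot] at this
      exact hxi this
    · obtain ⟨p, rfl⟩ := hrep α
      rw [hrange, ← Subgroup.map_top_of_surjective (MulAut.conj (p i)).toMonoidHom (MulAut.conj (p i)).surjective] at h
      have hR := Subgroup.map_injective (f := (MulAut.conj (p i)).toMonoidHom)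
        (MulAut.conj (p i)).injective h
      -- A full projection would make T a quotient of a subgroup of the solvable group H.
      have hs : Group.IsSolvable (H.comap ψ) := by
        let f : H.comap ψ →* H := (ψ.comp (H.comap ψ).subtype).codRestrict H fun x => x.2
        exact Group.isSolvable_of_isSolvable_injective (f := f) fun x y hxy =>
          Subtype.ext (hψ (congrArg Subtype.val hxy))
      have hTs : Group.IsSolvable T := by
        refine Group.isSolvable_of_surjective
          (f := (Pi.evalMonoidHom (fun _ : Fin n => T) i).comp (H.comap ψ).subtype) ?_
        intro t
        have : t ∈ R i := hR ▸ Subgroup.mem_top t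
        obtain ⟨x, hx, rfl⟩ := this
        exact ⟨⟨x, hx⟩, rfl⟩
      obtain ⟨a, b, hab⟩ := hT
      exact hab (IsSimpleGroup.comm_iff_isSolvable.mpr hTs a b)
    · obtain ⟨p, rfl⟩ := hrep α
      obtain ⟨e⟩ := hRiso i j
      rw [hrange, hrange]
      exact ⟨(((R i).equivMapOfInjective _ (MulAut.conj (p i)).injective).symm.trans e).trans
        ((R j).equivMapOfInjective _ (MulAut.conj (p j)).injective)⟩
  · intro α hα
    obtain ⟨p, rfl⟩ := hrep α
    apply hx₀1
    let m : MulAction.stabilizer (socle (⊤ : Subgroup G)) ((ψ p : G) : G ⧸ H) :=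
      ⟨φ.symm (p * x₀ * p⁻¹), by
        change ((φ.symm (p * x₀ * p⁻¹) : (⊤ : Subgroup G)) : G) • ((ψ p : G) : G ⧸ H) = (ψ p : G)
        rw [hφs, hstab]
        convert hx₀ using 2
        group⟩
    have h1 : stabProj φ ((ψ p : G) : G ⧸ H) i₀ m = 1 := by
      change φ (φ.symm (p * x₀ * p⁻¹)) i₀ = 1
      rw [MulEquiv.apply_symm_apply]
      simp [hx₀i]
    have h2 : m = 1 := hα i₀ (h1.trans (map_one _).symm)
    have h3 : φ.symm (p * x₀ * p⁻¹) = 1 := congrArg Subtype.val h2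
    rw [map_eq_one_iff _ φ.symm.injective] at h3
    have : x₀ = p⁻¹ * (p * x₀ * p⁻¹) * p := by group
    rw [this, h3]; group

end ProductAction

/-! ### The norm of a generator of the quadratic extension -/

lemma exists_quadratic_extension (F : Type) [Field F] [Finite F]
    (hF : Even (Nat.card F) ∨ (Nat.card F : ℤ) ≡ -1 [ZMOD 4]) :
    ∃ (L : Type) (_ : Field L) (_ : Algebra F L) (w : Lˣ) (u : Fˣ),
      Nat.card L = Nat.card F ^ 2 ∧ Module.finrank F L = 2 ∧ (∀ x, x ∈ Subgroup.zpowers w) ∧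
      (w : L) ^ (Nat.card F + 1) = algebraMap F L (-(u : F) ^ 2) := by
  obtain ⟨p, hp⟩ := CharP.exists F
  have : Fact p.Prime := ⟨CharP.char_is_prime F p⟩
  have := Fintype.ofFinite F
  have hq1 : 1 < Nat.card F := Finite.one_lt_card
  have hcard := FiniteField.natCard_extension F p 2
  have : Fintype (FiniteField.Extension F p 2) := Fintype.ofFinite _
  have hrank : Module.finrank F (FiniteField.Extension F p 2) = 2 := by
    have h1 := Module.natCard_eq_pow_finrank (K := F) (V := FiniteField.Extension F p 2)
    rw [hcard] at h1
    exact (Nat.pow_right_injective hq1 h1).symm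
  obtain ⟨w, hw⟩ := IsCyclic.exists_generator (α := (FiniteField.Extension F p 2)ˣ)
  set L := FiniteField.Extension F p 2
  have hord : orderOf w = Nat.card F ^ 2 - 1 := by
    rw [orderOf_eq_card_of_forall_mem_zpowers hw, Nat.card_units, hcard]
  set v : F := Algebra.norm F (w : L)
  have hv : algebraMap F L v = (w : L) ^ (Nat.card F + 1) := by
    rw [FiniteField.algebraMap_norm_eq_pow, hcard]
    congr 1
    apply Nat.div_eq_of_eq_mul_left (by omega)
    rw [← Nat.sq_sub_sq, one_pow]
  have hv0 : v ≠ 0 := by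
    intro h
    rw [h, map_zero] at hv
    exact pow_ne_zero _ w.ne_zero hv.symm
  have hsq : IsSquare (-v) := by
    by_cases h2 : ringChar F = 2
    · exact FiniteField.isSquare_of_char_two h2 _
    have hodd := FiniteField.odd_card_of_char_ne_two h2
    rw [← Nat.card_eq_fintype_card] at hodd
    have hmod : Nat.card F % 4 = 3 := by
      rcases hF with h | h
      · rw [Nat.even_iff] at h; omega
      · have := h.dvd; omega
    rw [FiniteField.isSquare_iff h2 (neg_ne_zero.mpr hv0), neg_pow,
      ← Nat.card_eq_fintype_card, Odd.neg_one_pow (by rw [Nat.odd_iff]; omega)]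
    -- By Euler's criterion -v is a square once v^((q-1)/2) = -1, the exponent being odd. The value
    -- 1 would give w^((q+1)(q-1)/2) = 1, against the order q² - 1 of w.
    have hne : v ^ (Nat.card F / 2) ≠ 1 := by
      intro h
      have h1 : w ^ ((Nat.card F + 1) * (Nat.card F / 2)) = 1 := by
        apply Units.ext
        rw [Units.val_pow_eq_pow_val, pow_mul, ← hv, ← map_pow, h, map_one, Units.val_one]
      have h2 := Nat.le_of_dvd (Nat.mul_pos (by omega) (by omega)) (orderOf_dvd_of_pow_eq_one h1)
      rw [hord] at h2
      obtain ⟨m, hm⟩ : ∃ m, Nat.card F = 2 * m + 1 := ⟨Nat.card F / 2, by omega⟩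
      rw [hm] at h2
      have h3 : (2 * m + 1) / 2 = m := by omega
      rw [h3] at h2
      have : (2 * m + 1) ^ 2 - 1 = (2 * m + 1 + 1) * m + (2 * m + 2) * m := by
        apply Nat.sub_eq_of_eq_add; ring
      rw [this] at h2
      have : 0 < (2 * m + 2) * m := Nat.mul_pos (by omega) (by omega)
      omega
    rcases FiniteField.pow_dichotomy h2 hv0 with h | h
    · rw [← Nat.card_eq_fintype_card] at h; exact absurd h hne
    · rw [← Nat.card_eq_fintype_card] at h; rw [h]; ring
  obtain ⟨u, hu⟩ := hsq
  have hu0 : u ≠ 0 := by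
    rintro rfl
    exact hv0 (by simpa using hu)
  refine ⟨L, inferInstance, inferInstance, w, Units.mk0 u hu0, hcard, hrank, hw, ?_⟩
  rw [← hv, Units.val_mk0, pow_two, ← hu, neg_neg]

/-! ### Factor data and twisted shifts -/

/-- Data on a group `T` that extends the action of `F ⋊ Fˣ` on the translation group `F ≤ T`: the
units of `F` act as automorphisms of `T`, and an involution of `T` inverts this action. -/
structure FactorData (F : Type*) [Field F] (T : Type*) [Group T] where
  δ : Fˣ →* MulAut T
  τ : Multiplicative F →* T
  s : T
  τ_injective : Function.Injective τ
  δ_τ : ∀ (a : Fˣ) (b : F), δ a (τ (.ofAdd b)) = τ (.ofAdd (a * b))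
  s_mul_s : s * s = 1
  conj_s_δ : ∀ (a : Fˣ) (t : T), s * δ a t * s⁻¹ = δ a⁻¹ (s * t * s⁻¹)
  generate : ∀ K : Subgroup T, (∀ b, τ b ∈ K) → (∀ b, s * τ b * s⁻¹ ∈ K) → K = ⊤

/-- The automorphism `x ↦ (i ↦ d i (x (i + 1)))` of a power of `T`. -/
def shiftAut {n : ℕ} {T : Type*} [Group T] (d : Fin (n + 1) → MulAut T) :
    MulAut (Fin (n + 1) → T) where
  toFun x i := d i (x (i + 1))
  invFun x i := (d (i - 1))⁻¹ (x (i - 1))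
  left_inv x := by ext i; simp
  right_inv x := by ext i; simp
  map_mul' x y := by ext i; simp

lemma shiftAut_apply {n : ℕ} {T : Type*} [Group T] (d : Fin (n + 1) → MulAut T)
    (x : Fin (n + 1) → T) (i : Fin (n + 1)) : shiftAut d x i = d i (x (i + 1)) := rfl

lemma Fin.val_nsmul_one {n : ℕ} (i : Fin (n + 1)) : i.val • (1 : Fin (n + 1)) = i := by
  induction i using Fin.induction with
  | zero => simp
  | succ i ih =>
    rw [Fin.val_succ, succ_nsmul, ← Fin.val_castSucc, ih, Fin.coeSucc_eq_succ]

section Shift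

variable {n : ℕ} {T : Type*} [Group T] {A : Type*} [CommGroup A] (δ : A →* MulAut T)
  (a : Fin (n + 1) → A)

lemma shiftAut_pow_apply (k : ℕ) (x : Fin (n + 1) → T) (i : Fin (n + 1)) :
    (shiftAut (fun j => δ (a j)) ^ k) x i =
      δ (∏ j ∈ Finset.range k, a (i + j • 1)) (x (i + k • 1)) := by
  induction k generalizing x with
  | zero => simp
  | succ k ih =>
    rw [pow_succ, MulAut.mul_apply, ih, shiftAut_apply, Finset.prod_range_succ, map_mul,
      MulAut.mul_apply, succ_nsmul, add_assoc]

lemma shiftAut_pow_succ_apply (x : Fin (n + 1) → T) (i : Fin (n + 1)) :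
    (shiftAut (fun j => δ (a j)) ^ (n + 1)) x i = δ (∏ j, a j) (x i) := by
  rw [shiftAut_pow_apply, Finset.prod_range]
  have h1 : (n + 1) • (1 : Fin (n + 1)) = 0 := by
    simpa using card_nsmul_eq_zero (G := Fin (n + 1)) (x := 1)
  have h2 : ∏ j : Fin (n + 1), a (i + j.val • 1) = ∏ j, a j := by
    simp only [Fin.val_nsmul_one]
    exact Equiv.prod_comp (Equiv.addLeft i) a
  rw [h1, h2, add_zero]

lemma exists_shiftAut_pow_apply (i j : Fin (n + 1)) :
    ∃ (k : ℕ) (e : MulAut T), (∀ x, (shiftAut (fun l => δ (a l)) ^ k) x j = e (x i)) ∧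
      ∀ t, (shiftAut (fun l => δ (a l)) ^ k) (Pi.mulSingle i t) = Pi.mulSingle j (e t) := by
  -- The k-th power of the shift reads coordinate j + k at position j, so k = i - j.
  refine ⟨(i - j).val, δ (∏ l ∈ Finset.range (i - j).val, a (j + l • 1)), ?_, ?_⟩
  · intro x
    rw [shiftAut_pow_apply, Fin.val_nsmul_one, add_sub_cancel]
  · intro t
    ext l
    rw [shiftAut_pow_apply, Fin.val_nsmul_one]
    by_cases hl : l = j
    · subst hl
      simp
    · have : l + (i - j) ≠ i := fun h => hl (by
        have := congrArg (· - (i - j)) h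
        simpa using this)
      simp [hl, this]

end Shift

/-- The multipliers `u, …, u, -u`. -/
def twist {F : Type*} [Field F] (u : Fˣ) (n : ℕ) (i : Fin (n + 1)) : Fˣ :=
  if i = Fin.last n then -u else u

lemma prod_twist {F : Type*} [Field F] (u : Fˣ) (n : ℕ) :
    ∏ i, twist u n i = -u ^ (n + 1) := by
  rw [Fin.prod_univ_castSucc]
  simp [twist, Fin.castSucc_ne_last, pow_succ]

/-! ### Functionals permuted by a generator of Lˣ -/

/-- The plane `L` over `F` is realized by functionals `ℓ i`, one for each point of the projective
line over `F`, such that a generator `w` of `Lˣ` shifts the functionals up to scalars. -/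
lemma exists_shifted_functionals (F : Type) [Field F] [Finite F]
    (hF : Even (Nat.card F) ∨ (Nat.card F : ℤ) ≡ -1 [ZMOD 4]) :
    ∃ (L : Type) (_ : Field L) (_ : Algebra F L) (w : Lˣ) (u : Fˣ)
      (ℓ : Fin (Nat.card F + 1) → L →ₗ[F] F),
      Nat.card L = Nat.card F ^ 2 ∧ (∀ x, x ∈ Subgroup.zpowers w) ∧
      (∀ i b, ℓ i (w * b) = twist u (Nat.card F) i * ℓ (i + 1) b) ∧
      (∀ i, Function.Surjective (ℓ i)) ∧
      (∀ i j, i ≠ j → ∃ b, ℓ i b = 0 ∧ ℓ j b ≠ 0) ∧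
      (∀ v : Fˣ, v ∈ Subgroup.zpowers (-u ^ 2)) := by
  obtain ⟨L, _, _, w, u, hcard, hrank, hw, hwu⟩ := exists_quadratic_extension F hF
  set q := Nat.card F
  have hq1 : 1 < q := Finite.one_lt_card
  have hL : Finite L := Nat.finite_of_card_ne_zero (by rw [hcard]; positivity)
  have hord : orderOf w = (q + 1) * (q - 1) := by
    rw [orderOf_eq_card_of_forall_mem_zpowers hw, Nat.card_units, hcard, ← Nat.sq_sub_sq, one_pow]
  have hupow : ∀ v : Fˣ, v ^ (q - 1) = 1 := by
    intro v
    rw [← Nat.card_units]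
    exact pow_card_eq_one'
  let ι : Fˣ →* Lˣ := Units.map (algebraMap F L).toMonoidHom
  have hι : Function.Injective ι := Units.map_injective (algebraMap F L).injective
  -- Units of F are killed by q - 1, while w has order (q+1)(q-1).
  have hdvd : ∀ (v : Fˣ) (m : ℤ), ι v = w ^ m → ((q + 1 : ℕ) : ℤ) ∣ m := by
    intro v m h
    have h1 : w ^ (m * (q - 1 : ℕ)) = 1 := by
      rw [zpow_mul, ← h, zpow_natCast, ← map_pow, hupow, map_one]
    have h2 := orderOf_dvd_iff_zpow_eq_one.mpr h1
    rw [hord, Nat.cast_mul] at h2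
    exact Int.dvd_of_mul_dvd_mul_right (by omega) h2
  have hwu' : w ^ (q + 1) = ι (-u ^ 2) := by
    apply Units.ext
    rw [Units.val_pow_eq_pow_val, hwu]
    simp [ι]
  let μ : Lˣ := w * (ι u)⁻¹
  -- This value produces the minus sign in the last multiplier, where the index wraps around from q
  -- to 0.
  have hμ : μ ^ (q + 1) = -1 := by
    have : u ^ (q + 1) = u ^ 2 := by
      rw [show q + 1 = (q - 1) + 2 by omega, pow_add, hupow, one_mul]
    rw [mul_pow, hwu', inv_pow, ← map_pow, this, ← map_inv, ← map_mul, neg_mul, mul_inv_cancel]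
    apply Units.ext
    simp [ι]
  obtain ⟨f, hf⟩ : ∃ f : L →ₗ[F] F, f ≠ 0 := by
    have := FiniteDimensional.of_finrank_pos (K := F) (V := L) (by omega)
    have : Nontrivial (Module.Dual F L) := inferInstance
    exact exists_ne 0
  have hfs : Function.Surjective f := LinearMap.surjective hf
  let ℓ : Fin (q + 1) → L →ₗ[F] F := fun i => f ∘ₗ LinearMap.mulLeft F ((μ : L) ^ (i : ℕ))
  have hℓ : ∀ i b, ℓ i b = f ((μ : L) ^ (i : ℕ) * b) := fun _ _ => rfl
  have hμw : (w : L) = algebraMap F L u * μ := by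
    change _ = ((ι u : Lˣ) : L) * μ
    rw [← Units.val_mul, mul_comm, inv_mul_cancel_right]
  refine ⟨L, inferInstance, inferInstance, w, u, ℓ, hcard, hw, ?_, ?_, ?_, ?_⟩
  · intro i b
    rw [hℓ, hℓ, hμw, show (μ : L) ^ (i : ℕ) * (algebraMap F L u * μ * b) =
      algebraMap F L u * ((μ : L) ^ ((i : ℕ) + 1) * b) by ring, ← Algebra.smul_def, map_smul,
      smul_eq_mul, twist]
    by_cases hi : i = Fin.last q
    · subst hi
      have : (μ : L) ^ (q + 1) = -1 := by rw [← Units.val_pow_eq_pow_val, hμ]; simp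
      simp [this]
    · rw [if_neg hi, Fin.val_add_one_of_lt (Fin.lt_last_iff_ne_last.mpr hi)]
  · intro i t
    obtain ⟨b, rfl⟩ := hfs t
    refine ⟨(μ : L)⁻¹ ^ (i : ℕ) * b, ?_⟩
    rw [hℓ, ← mul_assoc, ← mul_pow, mul_inv_cancel₀ μ.ne_zero, one_pow, one_mul]
  · intro i j hij
    have hker : Module.finrank F (LinearMap.ker f) = 1 := by
      have := FiniteDimensional.of_finrank_pos (K := F) (V := L) (by omega)
      have h1 := f.finrank_range_add_finrank_ker
      rw [LinearMap.range_eq_top.mpr hfs, finrank_top, Module.finrank_self, hrank] at h1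
      omega
    obtain ⟨⟨c, hc⟩, hc0, hcs⟩ := finrank_eq_one_iff'.mp hker
    have hc0' : c ≠ 0 := fun h => hc0 (Subtype.ext h)
    refine ⟨(μ : L)⁻¹ ^ (i : ℕ) * c, ?_, ?_⟩
    · rw [hℓ, ← mul_assoc, ← mul_pow, mul_inv_cancel₀ μ.ne_zero, one_pow, one_mul]
      exact hc
    -- If this vector were an eigenvector, that is, if ker f contained its multiple by μ^j, then
    -- μ^(j-i) and hence w^(j-i) would lie in F, so q + 1 would divide j - i.
    · intro h
      obtain ⟨v, hv⟩ := hcs ⟨_, h⟩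
      have hv' : algebraMap F L v * c = (μ : L) ^ (j : ℕ) * ((μ : L)⁻¹ ^ (i : ℕ) * c) := by
        rw [← Algebra.smul_def]; exact congrArg Subtype.val hv
      rw [← mul_assoc] at hv'
      have hv2 := mul_right_cancel₀ hc0' hv'
      have hv0 : v ≠ 0 := by
        rintro rfl
        rw [map_zero] at hv2
        exact mul_ne_zero (pow_ne_zero _ μ.ne_zero) (pow_ne_zero _ (inv_ne_zero μ.ne_zero)) hv2.symm
      have hv3 : ι (Units.mk0 v hv0) = μ ^ ((j : ℤ) - (i : ℤ)) := by
        apply Units.ext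
        rw [zpow_sub, zpow_natCast, zpow_natCast]
        simp only [Units.val_mul, Units.val_pow_eq_pow_val, Units.val_inv_eq_inv_val]
        rw [← inv_pow]
        exact hv2
      have h4 := hdvd (Units.mk0 v hv0 * u ^ ((j : ℤ) - (i : ℤ))) ((j : ℤ) - (i : ℤ)) (by
        rw [map_mul, hv3, map_zpow, ← mul_zpow, inv_mul_cancel_right])
      have h5 := Int.eq_zero_of_abs_lt_dvd h4 (by
        have := i.2; have := j.2
        rw [abs_lt]; push_cast; omega)
      exact hij (Fin.ext (by omega))
  -- The units of F are the powers of w with exponent divisible by q + 1, that is, the powers of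
  -- w^(q+1) = -u².
  · intro v
    obtain ⟨m, hm⟩ := Subgroup.mem_zpowers_iff.mp (hw (ι v))
    obtain ⟨k, rfl⟩ := hdvd v m hm.symm
    refine ⟨k, hι ?_⟩
    change ι ((-u ^ 2) ^ k) = ι v
    rw [map_zpow, ← hwu', ← hm, zpow_mul, zpow_natCast]

/-! ### The group AGL₁(L) and homomorphisms from it -/

section Affine

variable {L : Type*} [Field L]

/-- The multiplier of an affine permutation of the line. -/
def affineUnit : (L ≃ᵃ[L] L) →* Lˣ where
  toFun e := Units.mk0 (e.linear 1) (by simp)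
  map_one' := by ext; rfl
  map_mul' e e' := by
    ext
    change e.linear (e'.linear 1) = e.linear 1 * e'.linear 1
    conv_lhs => rw [← mul_one (e'.linear 1), ← smul_eq_mul, map_smul, smul_eq_mul, mul_comm]

lemma affine_apply (e : L ≃ᵃ[L] L) (x : L) : e x = affineUnit e * x + e 0 := by
  have h := e.map_vadd 0 x
  rw [vadd_eq_add, add_zero, vadd_eq_add] at h
  rw [h]
  congr 1
  change e.linear x = e.linear 1 * x
  conv_lhs => rw [← mul_one x, ← smul_eq_mul, map_smul, smul_eq_mul, mul_comm]

lemma exists_affine (a : Lˣ) (b : L) : ∃ e : L ≃ᵃ[L] L, e 0 = b ∧ affineUnit e = a := by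
  refine ⟨(LinearEquiv.smulOfUnit a).toAffineEquiv.trans (AffineEquiv.constVAdd L L b), ?_, ?_⟩
  · simp [AffineEquiv.trans_apply]
  · ext
    change a • (1 : L) = a
    simp [Units.smul_def]

lemma affine_ext {e e' : L ≃ᵃ[L] L} (h0 : e 0 = e' 0) (h : affineUnit e = affineUnit e') :
    e = e' := by
  ext x
  rw [affine_apply, affine_apply e', h0, h]

instance isSolvable_affine : Group.IsSolvable (L ≃ᵃ[L] L) := by
  refine Group.isSolvable_of_ker_le_range (AffineEquiv.constVAddHom L L)
    (affineUnit (L := L)) ?_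
  intro e he
  refine ⟨.ofAdd (e 0), affine_ext ?_ ?_⟩
  · simp
  · rw [MonoidHom.mem_ker.mp he]
    ext
    rfl

/-- A homomorphism from `AGL₁(L)` glued from its restrictions to `L` and to `Lˣ`. -/
def affineLift {G : Type*} [Group G] (ν : Multiplicative L →* G) (η : Lˣ →* G)
    (h : ∀ a b, η a * ν (.ofAdd b) = ν (.ofAdd (a * b)) * η a) : (L ≃ᵃ[L] L) →* G where
  toFun e := ν (.ofAdd (e 0)) * η (affineUnit e)
  map_one' := by
    rw [map_one, map_one, mul_one]
    exact map_one ν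
  map_mul' e e' := by
    have : (e * e') 0 = e 0 + affineUnit e * e' 0 := by
      rw [AffineEquiv.coe_mul, Function.comp_apply, affine_apply, add_comm]
    rw [this, ofAdd_add]
    simp only [map_mul]
    rw [mul_assoc (ν (.ofAdd (e 0))), ← mul_assoc (ν (.ofAdd (affineUnit e * e' 0))), ← h]
    simp only [mul_assoc]

lemma affineLift_apply {G : Type*} [Group G] (ν : Multiplicative L →* G) (η : Lˣ →* G)
    (h : ∀ a b, η a * ν (.ofAdd b) = ν (.ofAdd (a * b)) * η a) (e : L ≃ᵃ[L] L) :
    affineLift ν η h e = ν (.ofAdd (e 0)) * η (affineUnit e) := rfl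

/-- If ν(b)η(a) = 1, then η(a) lies in the abelian image of ν and commutes with ν(1). But it
conjugates ν(1) to ν(a), so a = 1, and then b = 0. -/
lemma affineLift_injective {G : Type*} [Group G] (ν : Multiplicative L →* G) (η : Lˣ →* G)
    (h : ∀ a b, η a * ν (.ofAdd b) = ν (.ofAdd (a * b)) * η a) (hν : Function.Injective ν) :
    Function.Injective (affineLift ν η h) := by
  rw [injective_iff_map_eq_one]
  intro e he
  rw [affineLift_apply] at he
  have h1 : η (affineUnit e) = ν (.ofAdd (-e 0)) := by
    rw [ofAdd_neg, map_inv]; exact eq_inv_of_mul_eq_one_right he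
  have h2 : ν (.ofAdd (1 + -e 0)) = ν (.ofAdd (affineUnit e * 1 + -e 0)) := by
    rw [add_comm 1, ofAdd_add, ofAdd_add, map_mul, map_mul, ← h1]
    exact h _ 1
  have h3 : 1 + -e 0 = affineUnit e * 1 + -e 0 := hν h2
  have h4 : (affineUnit e : L) = 1 := by
    rw [mul_one] at h3; exact (add_right_cancel h3).symm
  have h5 : affineUnit e = 1 := Units.ext h4
  rw [h5, map_one, mul_one, ← map_one ν] at he
  have h6 := congrArg Multiplicative.toAdd (hν he)
  refine affine_ext ?_ (h5.trans (map_one _).symm)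
  exact h6

end Affine

/-! ### Equivariance and extension by an automorphism -/

lemma zpow_smul_map {A B X Y : Type*} [Group A] [Group B] [MulAction A X] [MulAction B Y]
    {a : A} {b : B} {f : X → Y} (h : ∀ x, b • f x = f (a • x)) (k : ℤ) (x : X) :
    b ^ k • f x = f (a ^ k • x) := by
  induction k generalizing x with
  | zero => simp
  | succ k ih => rw [zpow_add_one, zpow_add_one, mul_smul, mul_smul, h, ih]
  | pred k ih =>
    rw [zpow_sub_one, zpow_sub_one, mul_smul, mul_smul, ← ih]
    congr 1
    rw [inv_smul_eq_iff, h, smul_inv_smul]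

/-- A centerless group `P` with an automorphism `S` embeds as a self-centralizing normal subgroup of
a group generated by `P` and an element that induces `S`. -/
lemma exists_extension_of_mulAut {P : Type} [Group P] [Finite P]
    (hP : ∀ x : P, (∀ y, x * y * x⁻¹ = y) → x = 1) (S : MulAut P) :
    ∃ (G : Type) (_ : Group G) (_ : Finite G) (ψ : P →* G) (θ : G), Function.Injective ψ ∧
      (∀ x, θ * ψ x * θ⁻¹ = ψ (S x)) ∧ (∀ y : G, (∀ x, y * ψ x * y⁻¹ = ψ x) → y = 1) ∧
      ψ.range ⊔ Subgroup.zpowers θ = ⊤ ∧ ψ.range.Normal := by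
  have hc : ∀ (α : MulAut P) (x : P), α * MulAut.conj x * α⁻¹ = MulAut.conj (α x) := by
    intro α x
    ext y
    simp
  have hci : Function.Injective (MulAut.conj : P →* MulAut P) := by
    rw [injective_iff_map_eq_one]
    intro x hx
    exact hP x fun y => by rw [← MulAut.conj_apply, hx, MulAut.one_apply]
  -- The extension is realized inside Aut P as Inn P · ⟨S⟩; an automorphism commuting with all inner
  -- ones is trivial since P has trivial centre.
  let A : Subgroup (MulAut P) := (MulAut.conj : P →* MulAut P).range ⊔ Subgroup.zpowers S
  have hθA : S ∈ A := Subgroup.mem_sup_right (Subgroup.mem_zpowers S)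
  let ψ : P →* A := MulAut.conj.codRestrict A fun x => Subgroup.mem_sup_left ⟨x, rfl⟩
  have hfin : Finite (MulAut P) := Finite.of_injective (fun e : MulAut P => (e : P → P))
    DFunLike.coe_injective
  refine ⟨A, inferInstance, inferInstance, ψ, ⟨S, hθA⟩, ?_, ?_, ?_, ?_, ?_⟩
  · exact fun x y h => hci (congrArg Subtype.val h)
  · exact fun x => Subtype.ext (hc S x)
  · intro y hy
    refine Subtype.ext ?_
    ext x
    have h1 : (y : MulAut P) * MulAut.conj x * (y : MulAut P)⁻¹ = MulAut.conj x :=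
      congrArg Subtype.val (hy x)
    rw [hc] at h1
    exact hci h1
  · have h1 : (ψ.range ⊔ Subgroup.zpowers (⟨S, hθA⟩ : A)).map A.subtype = A := by
      rw [Subgroup.map_sup, MonoidHom.map_zpowers, MonoidHom.map_range]
      rfl
    apply Subgroup.map_injective A.subtype_injective
    rw [h1, ← MonoidHom.range_eq_map, Subgroup.range_subtype]
  · refine ⟨?_⟩
    rintro _ ⟨x, rfl⟩ y
    exact ⟨(y : MulAut P) x, Subtype.ext (hc y x).symm⟩

/-! ### The embedded plane and the twisted shift -/

section Construction

variable {F L T : Type*} [Field F] [Field L] [Algebra F L] [Group T] (D : FactorData F T) {n : ℕ}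

/-- The embedding of `L` in `T^(n+1)` with coordinate functionals `ℓ i`. -/
def coordHom (ℓ : Fin (n + 1) → L →ₗ[F] F) : Multiplicative L →* (Fin (n + 1) → T) where
  toFun b i := D.τ (.ofAdd (ℓ i b.toAdd))
  map_one' := by ext i; simp
  map_mul' b c := by ext i; simp

lemma coordHom_apply (ℓ : Fin (n + 1) → L →ₗ[F] F) (b : L) (i : Fin (n + 1)) :
    coordHom D ℓ (.ofAdd b) i = D.τ (.ofAdd (ℓ i b)) := rfl

lemma FactorData.τ_eq_one_iff (b : F) : D.τ (.ofAdd b) = 1 ↔ b = 0 :=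
  map_eq_one_iff _ D.τ_injective

/-- The automorphism of `T^(n+1)` that shifts the coordinates with multipliers `u, …, u, -u`. -/
def FactorData.shift (u : Fˣ) (n : ℕ) : MulAut (Fin (n + 1) → T) :=
  shiftAut fun j => D.δ (twist u n j)

lemma shift_coordHom {ℓ : Fin (n + 1) → L →ₗ[F] F} {u : Fˣ} {w : Lˣ}
    (hℓ : ∀ i b, ℓ i (w * b) = twist u n i * ℓ (i + 1) b) (b : L) :
    D.shift u n (coordHom D ℓ (.ofAdd b)) = coordHom D ℓ (.ofAdd (w * b)) := by
  ext i
  rw [FactorData.shift, shiftAut_apply, coordHom_apply, coordHom_apply, D.δ_τ, hℓ]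

lemma shift_zpow_coordHom {ℓ : Fin (n + 1) → L →ₗ[F] F} {u : Fˣ} {w : Lˣ}
    (hℓ : ∀ i b, ℓ i (w * b) = twist u n i * ℓ (i + 1) b) (k : ℤ) (b : L) :
    (D.shift u n ^ k) (coordHom D ℓ (.ofAdd b)) =
      coordHom D ℓ (.ofAdd (((w ^ k : Lˣ) : L) * b)) :=
  zpow_smul_map (a := w) (b := D.shift u n) (f := fun b : L => coordHom D ℓ (.ofAdd b))
    (shift_coordHom D hℓ) k b

lemma coordHom_injective {ℓ : Fin (n + 1) → L →ₗ[F] F}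
    (hrank : ∀ b ≠ 0, ∃ i, ℓ i b ≠ 0) : Function.Injective (coordHom D ℓ) := by
  rw [injective_iff_map_eq_one]
  intro b hb
  by_contra hb0
  obtain ⟨i, hi⟩ := hrank b.toAdd hb0
  exact hi ((D.τ_eq_one_iff _).mp (congrFun hb i))

lemma shift_pow_succ_zpow_apply {u : Fˣ} (hu : u ^ (n + 1) = u ^ 2) (k : ℤ)
    (x : Fin (n + 1) → T) (i : Fin (n + 1)) :
    ((D.shift u n ^ (n + 1)) ^ k) x i = D.δ ((-u ^ 2) ^ k) (x i) := by
  rw [map_zpow]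
  refine (zpow_smul_map (X := Fin (n + 1) → T) (Y := T) (a := D.shift u n ^ (n + 1))
    (b := D.δ (-u ^ 2)) (f := fun x => x i) (fun y => ?_) k x).symm
  change D.δ (-u ^ 2) (y i) = (D.shift u n ^ (n + 1)) y i
  rw [FactorData.shift, shiftAut_pow_succ_apply, prod_twist, hu]

/-- Conjugation by s inverts each multiplier. As (±u)⁻¹ = u⁻²(±u), this rescales all multipliers by
the same factor u⁻², and a power of S^(n+1) supplies this factor. -/
lemma exists_shift_zpow_eq_conj {u : Fˣ} (hu : u ^ (n + 1) = u ^ 2)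
    (hgen : ∀ v : Fˣ, v ∈ Subgroup.zpowers (-u ^ 2)) :
    ∃ k : ℤ, ∀ x : Fin (n + 1) → T,
      (fun i => D.s * (D.shift u n (fun j => D.s * x j * D.s⁻¹)) i * D.s⁻¹) =
        (D.shift u n ^ k) x := by
  obtain ⟨k, hk⟩ := Subgroup.mem_zpowers_iff.mp (hgen (u ^ 2)⁻¹)
  refine ⟨(n + 1 : ℕ) * k + 1, fun x => ?_⟩
  have hsi : D.s⁻¹ = D.s := inv_eq_of_mul_eq_one_left D.s_mul_s
  ext i
  rw [zpow_add, zpow_mul, zpow_natCast, zpow_one, MulAut.mul_apply, shift_pow_succ_zpow_apply D hu,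
    hk]
  simp only [FactorData.shift, shiftAut_apply]
  rw [D.conj_s_δ, ← MulAut.mul_apply, ← map_mul]
  congr 2
  · have : (u ^ 2)⁻¹ * twist u n i = (twist u n i)⁻¹ := by
      rw [inv_mul_eq_iff_eq_mul, eq_mul_inv_iff_mul_eq, twist]
      split_ifs
      · rw [neg_mul_neg, pow_two]
      · rw [pow_two]
    rw [this]
  · rw [hsi, mul_assoc, mul_assoc, mul_assoc, D.s_mul_s, mul_one, ← mul_assoc, D.s_mul_s, one_mul]

lemma eq_top_of_coordHom_mem [IsSimpleGroup T] (hT : ∃ x y : T, x * y ≠ y * x)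
    {ℓ : Fin (n + 1) → L →ₗ[F] F} (hsurj : ∀ i, Function.Surjective (ℓ i))
    (hsep : ∀ i j, i ≠ j → ∃ b, ℓ i b = 0 ∧ ℓ j b ≠ 0) (K : Subgroup (Fin (n + 1) → T))
    (h1 : ∀ b, coordHom D ℓ b ∈ K)
    (h2 : ∀ b, (fun _ => D.s) * coordHom D ℓ b * (fun _ => D.s)⁻¹ ∈ K) : K = ⊤ := by
  refine eq_top_of_subdirect_of_separating hT K ?_ ?_
  · intro i t
    have htop : K.map (Pi.evalMonoidHom (fun _ => T) i) = ⊤ := by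
      refine D.generate _ ?_ ?_
      · intro b
        obtain ⟨c, hc⟩ := hsurj i b.toAdd
        exact ⟨_, h1 (.ofAdd c), by
          rw [Pi.evalMonoidHom_apply, coordHom_apply, hc]; rfl⟩
      · intro b
        obtain ⟨c, hc⟩ := hsurj i b.toAdd
        exact ⟨_, h2 (.ofAdd c), by
          rw [Pi.evalMonoidHom_apply, Pi.mul_apply, Pi.mul_apply, coordHom_apply, hc]; rfl⟩
    obtain ⟨x, hx, hxt⟩ := htop ▸ Subgroup.mem_top t
    exact ⟨x, hx, hxt⟩
  · intro i j hij
    obtain ⟨b, hb, hb'⟩ := hsep i j hij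
    refine ⟨_, h1 (.ofAdd b), ?_, ?_⟩
    · rw [coordHom_apply, D.τ_eq_one_iff, hb]
    · rwa [coordHom_apply, Ne, D.τ_eq_one_iff]

end Construction

/-! ### The graph of given factor data -/

theorem existsNonDiagonalPAGraph_of_factorData {F T : Type} [Field F] [Finite F] [Group T]
    [Finite T] [IsSimpleGroup T] (hT : ∃ x y : T, x * y ≠ y * x) (D : FactorData F T)
    (hF : Even (Nat.card F) ∨ (Nat.card F : ℤ) ≡ -1 [ZMOD 4]) :
    ExistsNonDiagonalPAGraph (Nat.card F) T := by
  obtain ⟨L, _, _, w, u, ℓ, hcard, hw, hℓ, hsurj, hsep, hgenu⟩ := exists_shifted_functionals F hF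
  have hq1 : 1 < Nat.card F := Finite.one_lt_card
  have hupow : ∀ v : Fˣ, v ^ (Nat.card F - 1) = 1 := by
    intro v
    rw [← Nat.card_units]
    exact pow_card_eq_one'
  clear hF
  generalize Nat.card F = q at *
  have hL : Finite L := Nat.finite_of_card_ne_zero (by rw [hcard]; positivity)
  have hu : u ^ (q + 1) = u ^ 2 := by
    rw [show q + 1 = (q - 1) + 2 by omega, pow_add, hupow, one_mul]
  have hworder : orderOf w = q ^ 2 - 1 := by
    rw [orderOf_eq_card_of_forall_mem_zpowers hw, Nat.card_units, hcard]
  set S := D.shift u q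
  have hcenter : ∀ x : Fin (q + 1) → T, (∀ y, x * y * x⁻¹ = y) → x = 1 := by
    intro x hx
    ext i
    by_contra hi
    obtain ⟨t, ht⟩ := exists_commutator_ne_one hT hi
    have := congrFun (hx fun _ => t) i
    exact ht (mul_inv_eq_one.mpr this)
  obtain ⟨G, _, _, ψ, θ, hψ, hθ, hcent, hgen, hnorm⟩ := exists_extension_of_mulAut hcenter S
  have hθk : ∀ (k : ℤ) x, θ ^ k * ψ x * (θ ^ k)⁻¹ = ψ ((S ^ k) x) := by
    intro k x
    have := zpow_smul_map (X := Fin (q + 1) → T) (Y := G) (a := S) (b := MulAut.conj θ) (f := ψ)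
      hθ k x
    rw [← map_zpow] at this
    exact this
  have hcent2 : ∀ y z : G, (∀ x, y * ψ x * y⁻¹ = z * ψ x * z⁻¹) → y = z := by
    intro y z h
    have : z⁻¹ * y = 1 := hcent _ fun x => by
      rw [mul_inv_rev, inv_inv, show z⁻¹ * y * ψ x * (y⁻¹ * z) = z⁻¹ * (y * ψ x * y⁻¹) * z by group,
        h]
      group
    exact (inv_mul_eq_one.mp this).symm
  let c := coordHom D ℓ
  have hc : Function.Injective c := by
    -- If all functionals vanished at some b ≠ 0, the shift would carry this to every multiple w^k
    -- b, that is, to all of L, against separation.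
    refine coordHom_injective D fun b hb => ?_
    by_contra! h
    obtain ⟨b₁, -, h₁⟩ := hsep 0 (Fin.last q) (by
      intro h; have := congrArg Fin.val h; simp at this; omega)
    obtain ⟨k, hk⟩ := Subgroup.mem_zpowers_iff.mp (hw (Units.mk0 b₁ (by
      rintro rfl; exact h₁ (map_zero _)) * (Units.mk0 b hb)⁻¹))
    have h2 := shift_zpow_coordHom D hℓ k b
    have hz : coordHom D ℓ (.ofAdd b) = 1 := by
      ext i
      rw [coordHom_apply, h, ofAdd_zero, map_one, Pi.one_apply]
    rw [hz, map_one, hk, Units.val_mul, Units.val_inv_eq_inv_val, Units.val_mk0, Units.val_mk0,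
      inv_mul_cancel_right₀ hb] at h2
    exact h₁ ((D.τ_eq_one_iff _).mp (congrFun h2.symm (Fin.last q)))
  have hcsep : ∀ i, ∃ b, c b ≠ 1 ∧ c b i = 1 := by
    intro i
    obtain ⟨j, hj⟩ : ∃ j, i ≠ j := by
      have : Nontrivial (Fin (q + 1)) := Fin.nontrivial_iff_two_le.mpr (by omega)
      obtain ⟨j, hj⟩ := exists_ne i
      exact ⟨j, hj.symm⟩
    obtain ⟨b, hb, hb'⟩ := hsep i j hj
    refine ⟨.ofAdd b, fun h => hb' ((D.τ_eq_one_iff _).mp (congrFun h j)), ?_⟩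
    exact (D.τ_eq_one_iff _).mpr hb
  have hccoord : ∀ i, ∃ b, c b i ≠ 1 := by
    intro i
    obtain ⟨b, hb⟩ := hsurj i 1
    exact ⟨.ofAdd b, fun h => one_ne_zero (hb.symm.trans ((D.τ_eq_one_iff _).mp h))⟩
  let ν : Multiplicative L →* G := ψ.comp c
  have hν : Function.Injective ν := hψ.comp hc
  have hθν : ∀ (k : ℤ) (b : L), θ ^ k * ν (.ofAdd b) = ν (.ofAdd ((w ^ k : Lˣ) * b)) * θ ^ k := by
    intro k b
    rw [← mul_inv_eq_iff_eq_mul]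
    exact (hθk k _).trans (congrArg ψ (shift_zpow_coordHom D hℓ k b))
  have hθorder : orderOf θ = q ^ 2 - 1 := by
    -- S^((q+1)(q-1)) acts as δ((-u²)^(q-1)) = 1 in each coordinate. Conversely θ acts on L as
    -- multiplication by w, which has order q² - 1.
    apply Nat.dvd_antisymm
    · rw [orderOf_dvd_iff_pow_eq_one]
      refine hcent _ fun x => ?_
      have h1 := hθk ((q ^ 2 - 1 : ℕ) : ℤ) x
      rw [zpow_natCast] at h1
      rw [h1]
      congr 1
      ext i
      have h2 := shift_pow_succ_zpow_apply D hu ((q - 1 : ℕ) : ℤ) x i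
      rw [zpow_natCast, zpow_natCast, hupow, map_one, MulAut.one_apply, ← pow_mul,
        ← Nat.sq_sub_sq, one_pow] at h2
      rw [zpow_natCast]
      exact h2
    · rw [← hworder, orderOf_dvd_iff_pow_eq_one]
      have h1 := hθν (orderOf θ) 1
      rw [zpow_natCast, zpow_natCast, pow_orderOf_eq_one, one_mul, mul_one, mul_one] at h1
      have h2 : (1 : L) = (w ^ orderOf θ : Lˣ) := hν h1
      exact (Units.ext h2).symm
  let η : Lˣ →* G := monoidHomOfForallMemZpowers hw (g' := θ) (by rw [hθorder, hworder])
  have hη : ∀ k : ℤ, η (w ^ k) = θ ^ k := fun k => by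
    rw [map_zpow, monoidHomOfForallMemZpowers_apply_gen]
  have hην : ∀ a b, η a * ν (.ofAdd b) = ν (.ofAdd (a * b)) * η a := by
    intro a b
    obtain ⟨k, rfl⟩ := Subgroup.mem_zpowers_iff.mp (hw a)
    rw [hη, hθν]
  let Ψ := affineLift ν η hην
  have hΨ : Function.Injective Ψ := affineLift_injective ν η hην hν
  let H : Subgroup G := Ψ.range
  have hmemH : ∀ (b) (k : ℤ), ν b * θ ^ k ∈ H := by
    intro b k
    obtain ⟨e, he0, he⟩ := exists_affine (w ^ k) b.toAdd
    refine ⟨e, ?_⟩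
    change affineLift ν η hην e = _
    rw [affineLift_apply, he0, he, hη]
    rfl
  have hνH : ∀ b, ν b ∈ H := fun b => by simpa using hmemH b 0
  have hθH : θ ∈ H := by simpa using hmemH 1 1
  have hsolv : Group.IsSolvable H :=
    Group.isSolvable_of_surjective (f := Ψ.rangeRestrict) Ψ.rangeRestrict_surjective
  have hnotle : ¬ ψ.range ≤ H := by
    intro hle
    have hTs : Group.IsSolvable T := by
      let f : T →* H := (ψ.comp (MonoidHom.mulSingle (fun _ => T) (0 : Fin (q + 1)))).codRestrict H
        fun t => hle ⟨_, rfl⟩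
      refine Group.isSolvable_of_isSolvable_injective (f := f) fun x y hxy => ?_
      exact Pi.mulSingle_injective (M := fun _ => T) (0 : Fin (q + 1))
        (hψ (congrArg Subtype.val hxy))
    obtain ⟨a, b, hab⟩ := hT
    exact hab (IsSimpleGroup.comm_iff_isSolvable.mpr hTs a b)
  set cs : Fin (q + 1) → T := fun _ => D.s
  have hcs : cs * cs = 1 := funext fun _ => D.s_mul_s
  let g : G := ψ cs
  have hg2 : g * g = 1 := by rw [← map_mul, hcs, map_one]
  have hgi : g⁻¹ = g := inv_eq_of_mul_eq_one_left hg2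
  have hgθ : ∃ k : ℤ, g⁻¹ * θ * g = θ ^ k := by
    obtain ⟨k, hk⟩ := exists_shift_zpow_eq_conj D hu hgenu
    refine ⟨k, hcent2 _ _ fun x => ?_⟩
    rw [hθk, ← hk, hgi]
    have h1 : ∀ y, ψ (cs * y * cs⁻¹) = g * ψ y * g⁻¹ := fun y => by
      rw [map_mul ψ, map_mul ψ, map_inv]
    calc g * θ * g * ψ x * (g * θ * g)⁻¹
        = g * (θ * (g * ψ x * g⁻¹) * θ⁻¹) * g⁻¹ := by group
      _ = g * ψ (S (cs * x * cs⁻¹)) * g⁻¹ := by rw [← h1, hθ]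
      _ = ψ (cs * S (cs * x * cs⁻¹) * cs⁻¹) := (h1 _).symm
  have hsup₀ : ∀ K : Subgroup G, (∀ b, ν b ∈ K) → (∀ b, g * ν b * g⁻¹ ∈ K) → ψ.range ≤ K := by
    intro K h1 h2
    have := eq_top_of_coordHom_mem D hT hsurj hsep (K.comap ψ) h1 (fun b => by
      change ψ (cs * c b * cs⁻¹) ∈ K
      rw [map_mul, map_mul, map_inv]
      exact h2 b)
    rintro _ ⟨x, rfl⟩
    have hx : x ∈ K.comap ψ := this ▸ Subgroup.mem_top x
    exact hx
  have hsup : ∀ K : Subgroup G, H ≤ K → (∀ h ∈ H, g * h * g⁻¹ ∈ K) → K = ⊤ := by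
    intro K h1 h2
    rw [eq_top_iff, ← hgen, sup_le_iff]
    refine ⟨hsup₀ K (fun b => h1 (hνH b)) (fun b => h2 _ (hνH b)), ?_⟩
    rw [Subgroup.zpowers_le]
    exact h1 hθH
  have hgH : g ∉ H := fun hgH => hnotle <| hsup₀ H hνH fun b =>
    H.mul_mem (H.mul_mem hgH (hνH b)) (H.inv_mem hgH)
  have hle : ∀ K : Subgroup G, K.Normal → K ≠ ⊥ → ψ.range ≤ K := by
    intro K hK hK0
    refine range_le_of_normal hT ψ hcent (fun i j => ?_) K hK0
    obtain ⟨k, e, -, he⟩ := exists_shiftAut_pow_apply D.δ (twist u q) i j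
    refine ⟨θ ^ (k : ℤ), e, fun t => ?_⟩
    rw [hθk, zpow_natCast, ← he]
    rfl
  have hcore : ∀ K : Subgroup G, K.Normal → K ≤ H → K = ⊥ := by
    intro K hK hKH
    by_contra h
    exact hnotle ((hle K hK h).trans hKH)
  let N : Subgroup G := ν.range
  have hNH : N ≤ H := by
    rintro _ ⟨b, rfl⟩
    exact hνH b
  have hfac : ∀ h ∈ H, ∃ n ∈ N, ∃ k : ℤ, h = n * θ ^ k := by
    rintro _ ⟨e, rfl⟩
    obtain ⟨k, hk⟩ := Subgroup.mem_zpowers_iff.mp (hw (affineUnit e))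
    refine ⟨_, ⟨.ofAdd (e 0), rfl⟩, k, ?_⟩
    change affineLift ν η hην e = _
    rw [affineLift_apply, ← hk, hη]
  have htr : ∀ n ∈ N, ∀ m ∈ N, n ≠ 1 → m ≠ 1 → ∃ k : ℤ, θ ^ k * n = m * θ ^ k := by
    rintro _ ⟨b, rfl⟩ _ ⟨d, rfl⟩ hb hd
    have hb0 : b.toAdd ≠ 0 := fun h => hb ((congrArg ν h).trans (map_one ν))
    have hd0 : d.toAdd ≠ 0 := fun h => hd ((congrArg ν h).trans (map_one ν))
    obtain ⟨k, hk⟩ := Subgroup.mem_zpowers_iff.mp (hw (Units.mk0 _ hd0 * (Units.mk0 _ hb0)⁻¹))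
    refine ⟨k, (hθν k b.toAdd).trans ?_⟩
    rw [hk, Units.val_mul, Units.val_inv_eq_inv_val, Units.val_mk0, Units.val_mk0,
      inv_mul_cancel_right₀ hb0]
    rfl
  -- If n ≠ 1, conjugating g⁻¹ng by powers of θ, which g normalizes, puts every conjugate gν(b)g⁻¹
  -- in H; then H contains P.
  have hsepN : ∀ n ∈ N, g⁻¹ * n * g ∈ H → n = 1 := by
    intro n hn hgn
    by_contra hn1
    refine hnotle (hsup₀ H hνH fun b => ?_)
    by_cases hb : ν b = 1
    · rw [hb, mul_one, mul_inv_cancel]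
      exact H.one_mem
    obtain ⟨k, hk⟩ := htr n hn _ ⟨b, rfl⟩ hn1 hb
    obtain ⟨j, hj⟩ := zpow_mul_eq_mul_zpow_of_conj hgθ k
    have h1 : ν b = θ ^ k * n * (θ ^ k)⁻¹ := by rw [hk]; group
    have h2 : θ ^ k * g = g * θ ^ j := hj
    have h3 : g * ν b * g⁻¹ = θ ^ j * (g⁻¹ * n * g) * (θ ^ j)⁻¹ := by
      have h4 : θ ^ j = g * θ ^ k * g := by
        rw [mul_assoc, h2, ← mul_assoc, hg2, one_mul]
      have h5 : (θ ^ j)⁻¹ = g * (θ ^ k)⁻¹ * g := by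
        rw [h4, mul_inv_rev, mul_inv_rev, hgi, mul_assoc]
      rw [h1, h5, h4, hgi]
      calc g * (θ ^ k * n * (θ ^ k)⁻¹) * g
          = g * θ ^ k * 1 * n * 1 * (θ ^ k)⁻¹ * g := by group
        _ = g * θ ^ k * (g * g) * n * (g * g) * (θ ^ k)⁻¹ * g := by rw [hg2]
        _ = _ := by simp only [mul_assoc]
    rw [h3]
    exact H.mul_mem (H.mul_mem (H.zpow_mem hθH j) hgn) (H.inv_mem (H.zpow_mem hθH j))
  have hsoc : socle G = ψ.range := by
    refine socle_eq_of_forall_le hnorm (fun h => hnotle (h ▸ bot_le)) hle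
  refine ⟨G, inferInstance, inferInstance, H, g, θ, cosetGraph H g hgH hg2,
    isCosetGraph_cosetGraph, cosetGraph_connected hsup, ?_,
    cosetGraph_isTwoArcTransitive hNH hθH hfac hgθ htr hcore, ?_, ?_, ?_, hθH, hθorder, L,
    inferInstance, hcard, ⟨(MonoidHom.ofInjective hΨ).symm⟩⟩
  · intro v
    rw [cosetGraph_ncard_neighborSet hNH hθH hfac hgθ hsepN, ← hcard]
    exact (Nat.card_congr (MonoidHom.ofInjective hν).toEquiv).symm
  · intro a b hab
    refine exists_isProductAction_of_eq_top hT (by omega) ψ hψ hnorm hle hsolv hcore ?_ ?_ ?_ ?_ _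
      (edgeGroup_cosetGraph_eq_top hsup hab)
    · intro x
      have hx : x ∈ ψ.range ⊔ Subgroup.zpowers θ := hgen ▸ Subgroup.mem_top x
      obtain ⟨_, ⟨p, rfl⟩, _, ⟨k, rfl⟩, rfl⟩ := Subgroup.mem_sup_of_normal_left.mp hx
      exact ⟨p, _, H.zpow_mem hθH k, rfl⟩
    · intro i
      obtain ⟨b, hb⟩ := hccoord i
      exact ⟨c b, hνH b, hb⟩
    · obtain ⟨b, hb, hb'⟩ := hcsep 0
      exact ⟨0, c b, hνH b, hb', hb⟩
    · intro i j
      obtain ⟨k, e, he, -⟩ := exists_shiftAut_pow_apply D.δ (twist u q) i j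
      refine ⟨θ ^ (k : ℤ), H.zpow_mem hθH k, e, fun x x' hx => ?_⟩
      rw [hθk, zpow_natCast] at hx
      rw [← hψ hx, ← he]
      rfl
  · exact ⟨(MulEquiv.subgroupCongr hsoc).trans (MonoidHom.ofInjective hψ).symm⟩
  · rw [hsoc, hgen]

/-! ### Factor data for PSL₂ -/

section ProjectiveSpecialLinear

open Matrix

variable {F : Type*} [Field F]

/-- The conjugate of a matrix in `SL₂(F)` by `diag(a, 1)`. -/
def slConjDiagFun (a : Fˣ) (A : Matrix.SpecialLinearGroup (Fin 2) F) : Matrix.SpecialLinearGroup (Fin 2) F :=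
  ⟨!![A 0 0, a * A 0 1; (a⁻¹ : Fˣ) * A 1 0, A 1 1], by
    have h := A.det_coe
    have ha : (a : F) * ((a⁻¹ : Fˣ) : F) = 1 := Units.mul_inv a
    rw [det_fin_two] at h
    rw [det_fin_two_of]
    linear_combination h - (A 0 1 * A 1 0) * ha⟩

lemma slConjDiagFun_coe (a : Fˣ) (A : Matrix.SpecialLinearGroup (Fin 2) F) :
    (slConjDiagFun a A : Matrix (Fin 2) (Fin 2) F) =
      !![A 0 0, a * A 0 1; (a⁻¹ : Fˣ) * A 1 0, A 1 1] := rfl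

/-- Conjugation of `SL₂(F)` by `diag(a, 1)`. -/
def slConjDiag (a : Fˣ) : Matrix.SpecialLinearGroup (Fin 2) F →* Matrix.SpecialLinearGroup (Fin 2) F where
  toFun := slConjDiagFun a
  map_one' := by
    ext i j
    rw [slConjDiagFun_coe]
    fin_cases i <;> fin_cases j <;> simp
  map_mul' A B := by
    ext i j
    have h : (a : F) * ((a⁻¹ : Fˣ) : F) = 1 := Units.mul_inv a
    have h' : ((a⁻¹ : Fˣ) : F) * (a : F) = 1 := Units.inv_mul a
    rw [Matrix.SpecialLinearGroup.coe_mul, slConjDiagFun_coe, slConjDiagFun_coe, slConjDiagFun_coe,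
      Matrix.SpecialLinearGroup.coe_mul]
    fin_cases i <;> fin_cases j <;>
      simp only [Matrix.mul_apply, Fin.sum_univ_two, Fin.zero_eta,
        Fin.mk_one, Matrix.of_apply, Matrix.cons_val', Matrix.cons_val_zero, Matrix.cons_val_one,
        Matrix.cons_val_fin_one]
    · linear_combination (-(A 0 1 * B 1 0)) * h
    · ring
    · ring
    · linear_combination (-(A 1 0 * B 0 1)) * h'

lemma slConjDiag_coe (a : Fˣ) (A : Matrix.SpecialLinearGroup (Fin 2) F) :
    (slConjDiag a A : Matrix (Fin 2) (Fin 2) F) =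
      !![A 0 0, a * A 0 1; (a⁻¹ : Fˣ) * A 1 0, A 1 1] := rfl

lemma slConjDiag_mul (a b : Fˣ) (A : Matrix.SpecialLinearGroup (Fin 2) F) :
    slConjDiag (a * b) A = slConjDiag a (slConjDiag b A) := by
  ext i j
  rw [slConjDiag_coe, slConjDiag_coe, slConjDiag_coe]
  fin_cases i <;> fin_cases j <;> simp [mul_assoc, mul_comm]

lemma slConjDiag_one (A : Matrix.SpecialLinearGroup (Fin 2) F) : slConjDiag 1 A = A := by
  ext i j
  rw [slConjDiag_coe]
  fin_cases i <;> fin_cases j <;> simp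

/-- The action of the torus `Fˣ` on `SL₂(F)` by diagonal automorphisms. -/
def slDiagAut : Fˣ →* MulAut (Matrix.SpecialLinearGroup (Fin 2) F) where
  toFun a := MonoidHom.toMulEquiv (slConjDiag a) (slConjDiag a⁻¹)
    (by ext1 A; simp [← slConjDiag_mul, slConjDiag_one])
    (by ext1 A; simp [← slConjDiag_mul, slConjDiag_one])
  map_one' := by ext1 A; exact slConjDiag_one A
  map_mul' a b := by ext1 A; exact slConjDiag_mul a b A

/-- Automorphisms act on the central quotient. -/
def mulAutCenterQuotient (G : Type*) [Group G] : MulAut G →* MulAut (G ⧸ Subgroup.center G) where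
  toFun e := QuotientGroup.congr _ _ e
    (Subgroup.characteristic_iff_map_eq.mp inferInstance e)
  map_one' := by
    ext x
    induction x using QuotientGroup.induction_on
    rfl
  map_mul' e f := by
    ext x
    induction x using QuotientGroup.induction_on
    rfl

/-- The matrix of the standard Weyl element. -/
def slWeyl (F : Type*) [Field F] : Matrix.SpecialLinearGroup (Fin 2) F := ⟨!![0, 1; -1, 0], by simp⟩

lemma slWeyl_coe : (slWeyl F : Matrix (Fin 2) (Fin 2) F) = !![0, 1; -1, 0] := rfl

lemma slWeyl_inv_coe : ((slWeyl F)⁻¹ : Matrix.SpecialLinearGroup (Fin 2) F).1 = !![0, -1; 1, 0] := by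
  rw [Matrix.SpecialLinearGroup.coe_inv, slWeyl_coe, adjugate_fin_two_of, neg_neg]

/-- The homomorphism from `F` to the upper unitriangular matrices. -/
def slUpper (F : Type*) [Field F] : Multiplicative F →* Matrix.SpecialLinearGroup (Fin 2) F where
  toFun b := Matrix.SpecialLinearGroup.transvection (zero_ne_one (α := Fin 2)) b.toAdd
  map_one' := by simp
  map_mul' _ _ := Matrix.SpecialLinearGroup.transvection_add _ _ _

lemma slUpper_coe (b : F) :
    (slUpper F (.ofAdd b) : Matrix (Fin 2) (Fin 2) F) = !![1, b; 0, 1] := by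
  change (Matrix.SpecialLinearGroup.transvection (zero_ne_one (α := Fin 2)) b : Matrix.SpecialLinearGroup (Fin 2) F).1 = _
  ext i j
  fin_cases i <;> fin_cases j <;> simp [Matrix.SpecialLinearGroup.transvection_coe, Matrix.single]

/-- The factor data of `PSL₂(F)`. -/
def factorDataPSL : FactorData F (ProjectiveSpecialLinearGroup (Fin 2) F) where
  δ := (mulAutCenterQuotient _).comp slDiagAut
  τ := (QuotientGroup.mk' _).comp (slUpper F)
  s := QuotientGroup.mk (slWeyl F)
  τ_injective := by
    rw [injective_iff_map_eq_one]
    intro b hb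
    have h := (QuotientGroup.eq_one_iff _).mp hb
    exact (Matrix.SpecialLinearGroup.transvection_mem_center_iff (zero_ne_one (α := Fin 2)) b.toAdd).mp h
  δ_τ a b := by
    change QuotientGroup.mk (slConjDiag a (slUpper F (.ofAdd b))) =
      QuotientGroup.mk (slUpper F (.ofAdd (a * b)))
    congr 1
    ext i j
    rw [slConjDiag_coe, slUpper_coe, slUpper_coe]
    fin_cases i <;> fin_cases j <;> simp
  s_mul_s := by
    -- The Weyl element squares to -1, which becomes trivial only modulo the centre.
    rw [← QuotientGroup.mk_mul, QuotientGroup.eq_one_iff, Matrix.SpecialLinearGroup.mem_center_iff]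
    refine ⟨-1, by simp, ?_⟩
    rw [Matrix.SpecialLinearGroup.coe_mul, slWeyl_coe]
    ext i j
    fin_cases i <;> fin_cases j <;> simp
  conj_s_δ a t := by
    induction t using QuotientGroup.induction_on with | _ A
    change QuotientGroup.mk (slWeyl F * slConjDiag a A * (slWeyl F)⁻¹) =
      QuotientGroup.mk (slConjDiag a⁻¹ (slWeyl F * A * (slWeyl F)⁻¹))
    congr 1
    ext i j
    rw [slConjDiag_coe, Matrix.SpecialLinearGroup.coe_mul, Matrix.SpecialLinearGroup.coe_mul, slConjDiag_coe,
      Matrix.SpecialLinearGroup.coe_mul, Matrix.SpecialLinearGroup.coe_mul]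
    rw [slWeyl_inv_coe, slWeyl_coe]
    fin_cases i <;> fin_cases j <;>
      simp [Matrix.mul_apply, Fin.sum_univ_two, Matrix.vecMul, dotProduct]
  generate K h1 h2 := by
    have htop : K.comap (QuotientGroup.mk' (Subgroup.center (Matrix.SpecialLinearGroup (Fin 2) F))) = ⊤ := by
      rw [eq_top_iff]
      intro A _
      refine Matrix.SL2.transvection_induction _ (fun i j hij b => ?_)
        (fun _ _ => mul_mem) A
      obtain ⟨rfl, rfl⟩ | ⟨rfl, rfl⟩ : i = 0 ∧ j = 1 ∨ i = 1 ∧ j = 0 := by omega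
      · exact h1 (.ofAdd b)
      · have h3 : slWeyl F * slUpper F (.ofAdd (-b)) * (slWeyl F)⁻¹ =
            Matrix.SpecialLinearGroup.transvection hij b := by
          ext i j
          rw [Matrix.SpecialLinearGroup.coe_mul, Matrix.SpecialLinearGroup.coe_mul, slUpper_coe, slWeyl_inv_coe,
            slWeyl_coe]
          fin_cases i <;> fin_cases j <;>
            simp [Matrix.SpecialLinearGroup.transvection_coe, Matrix.single]
        rw [← h3]
        exact h2 (.ofAdd (-b))
    rw [eq_top_iff]
    intro x _
    induction x using QuotientGroup.induction_on with | _ A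
    have : A ∈ K.comap (QuotientGroup.mk' (Subgroup.center (Matrix.SpecialLinearGroup (Fin 2) F))) :=
      htop ▸ Subgroup.mem_top A
    exact this

end ProjectiveSpecialLinear

/-- Factor data can be moved along an isomorphism. -/
def FactorData.congr {F : Type*} [Field F] {T T' : Type*} [Group T] [Group T'] (D : FactorData F T)
    (e : T ≃* T') : FactorData F T' where
  δ := (MulAut.congr e).toMonoidHom.comp D.δ
  τ := e.toMonoidHom.comp D.τ
  s := e D.s
  τ_injective := e.injective.comp D.τ_injective
  δ_τ a b := by
    change e (D.δ a (e.symm (e (D.τ (.ofAdd b))))) = e (D.τ (.ofAdd (a * b)))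
    rw [e.symm_apply_apply, D.δ_τ]
  s_mul_s := by rw [← map_mul, D.s_mul_s, map_one]
  conj_s_δ a t := by
    change e D.s * e (D.δ a (e.symm t)) * (e D.s)⁻¹ =
      e (D.δ a⁻¹ (e.symm (e D.s * t * (e D.s)⁻¹)))
    rw [← map_inv, ← map_mul, ← map_mul, D.conj_s_δ]
    congr 2
    rw [map_mul e.symm, map_mul e.symm, e.symm_apply_apply, e.symm_apply_apply]
  generate K h1 h2 := by
    have h := D.generate (K.comap e.toMonoidHom) h1 (fun b => by
      change e (D.s * D.τ b * D.s⁻¹) ∈ K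
      rw [map_mul, map_mul, map_inv]
      exact h2 b)
    rw [eq_top_iff]
    intro x _
    have : e.symm x ∈ K.comap e.toMonoidHom := h ▸ Subgroup.mem_top _
    have h3 : e (e.symm x) ∈ K := this
    rwa [e.apply_symm_apply] at h3

/-! ### Factor data for the alternating group of prime degree -/

section Alternating

open Equiv

/-- A transitive group of prime degree is primitive, and by Jordan's theorem a primitive group with
a 3-cycle contains the alternating group. -/
lemma alternatingGroup_subgroup_eq_top {α : Type*} [Fintype α] [DecidableEq α]
    (hα : (Nat.card α).Prime) (K : Subgroup (alternatingGroup α)) (x₀ : α)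
    (htrans : ∀ x, ∃ k ∈ K, (k : Perm α) x₀ = x)
    (hcycle : ∃ k ∈ K, (k : Perm α).IsThreeCycle) : K = ⊤ := by
  let M : Subgroup (Perm α) := K.map (alternatingGroup α).subtype
  have h0 : ∀ x, ∃ m : M, m • x₀ = x := fun x => by
    obtain ⟨k, hk, hkx⟩ := htrans x
    exact ⟨⟨k, k, hk, rfl⟩, hkx⟩
  have hM : MulAction.IsPretransitive M α := ⟨fun x y => by
    obtain ⟨m, rfl⟩ := h0 x
    obtain ⟨m', rfl⟩ := h0 y
    exact ⟨m' * m⁻¹, by rw [mul_smul, inv_smul_smul]⟩⟩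
  obtain ⟨k, hk, hk3⟩ := hcycle
  have hle := Perm.alternatingGroup_le_of_isPreprimitive_of_isThreeCycle_mem
    (MulAction.IsPreprimitive.of_prime_card (G := M) hα) hk3 ⟨k, hk, rfl⟩
  rw [eq_top_iff]
  rintro ⟨x, hx⟩ -
  obtain ⟨y, hy, hyx⟩ := hle hx
  have : y = ⟨x, hx⟩ := Subtype.ext hyx
  exact this ▸ hy

lemma neg_one_ne_one_of_odd_card {F : Type*} [Field F] [Fintype F]
    (hF : Odd (Fintype.card F)) : (-1 : F) ≠ 1 := by
  intro h
  have h2 : ringChar F = 2 := (neg_one_eq_one_iff).mp h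
  have := FiniteField.even_card_of_char_two h2
  rw [Nat.odd_iff] at hF
  omega

variable {F : Type*} [Field F] [Fintype F] [DecidableEq F]

/-- Translations of a field of odd order as even permutations. -/
def translationHom (hF : Odd (Fintype.card F)) : Multiplicative F →* alternatingGroup F :=
  (MulAction.toPermHom (Multiplicative F) F).codRestrict (alternatingGroup F) fun b => by
    rw [Equiv.Perm.mem_alternatingGroup]
    obtain ⟨m, hm⟩ := hF
    have h1 : b ^ Fintype.card F = 1 := by
      rw [← Fintype.card_multiplicative F]
      exact pow_card_eq_one
    have h2 := congrArg (Perm.sign ∘ MulAction.toPermHom (Multiplicative F) F) h1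
    simp only [Function.comp_apply, map_pow, map_one] at h2
    rwa [hm, pow_succ, pow_mul, Int.units_sq, one_pow, one_mul] at h2

lemma translationHom_apply (hF : Odd (Fintype.card F)) (b x : F) :
    (translationHom hF (.ofAdd b) : Perm F) x = b + x := rfl

/-- Inversion of a field with `3 mod 4` elements is an even permutation. -/
lemma sign_inv_eq_one (hF : Fintype.card F % 4 = 3) : Perm.sign (Equiv.inv F) = 1 := by
  have hne : (-1 : F) ≠ 1 := neg_one_ne_one_of_odd_card (Nat.odd_iff.mpr (by omega))
  -- With 0⁻¹ = 0 the fixed points are 0, 1, -1, so inversion is a product of (q-3)/2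
  -- transpositions, an even number.
  have hfix : Fintype.card (Function.fixedPoints (Equiv.inv F)) = 3 := by
    have : Function.fixedPoints (Equiv.inv F) = (({0, 1, -1} : Finset F) : Set F) := by
      ext x
      simp only [Function.mem_fixedPoints, Function.IsFixedPt, Equiv.inv_apply, Finset.coe_insert,
        Finset.coe_singleton, Set.mem_insert_iff, Set.mem_singleton_iff]
      exact (inv_eq_self₀ (a := x)).trans (by tauto)
    rw [← Nat.card_eq_fintype_card, this, Nat.card_coe_set_eq, Set.ncard_coe_finset,
      Finset.card_eq_three]
    exact ⟨0, 1, -1, zero_ne_one, by simp, hne.symm, rfl⟩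
  rw [Perm.sign_of_pow_two_eq_one (by ext x; simp [pow_two]), hfix]
  apply Even.neg_one_pow
  rw [Nat.even_iff]
  omega

/-- Off {0, 1, -1} the unsquared permutation is the involution x ↦ -1/x. The convention 0⁻¹ = 0
makes it cycle 0 → 1 → -1 → 0, so its square is a 3-cycle. -/
lemma isThreeCycle_of_translation_inv (hne : (-1 : F) ≠ 1) :
    (((Equiv.addLeft (1 : F) * (Equiv.inv F * Equiv.addLeft (-1) * (Equiv.inv F)⁻¹) *
      Equiv.addLeft 1) ^ 2 : Perm F)).IsThreeCycle := by
  have h : ((Equiv.addLeft (1 : F) * (Equiv.inv F * Equiv.addLeft (-1) * (Equiv.inv F)⁻¹) *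
      Equiv.addLeft 1) ^ 2 : Perm F) = swap 0 1 * swap 0 (-1) := by
    have hf : ∀ x : F, (Equiv.addLeft (1 : F) *
        (Equiv.inv F * Equiv.addLeft (-1) * (Equiv.inv F)⁻¹) * Equiv.addLeft 1 : Perm F) x =
        1 + (-1 + (1 + x)⁻¹)⁻¹ := fun x => rfl
    have hf' : ∀ x : F, x ≠ 0 → x ≠ -1 → 1 + (-1 + (1 + x)⁻¹)⁻¹ = -x⁻¹ := by
      intro x hx hx'
      have h1 : 1 + x ≠ 0 := fun h => hx' (eq_neg_of_add_eq_zero_right h)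
      have h2 : -1 + (1 + x)⁻¹ = -(x / (1 + x)) := by field_simp; ring
      rw [h2, inv_neg, inv_div]
      field_simp
      ring
    ext x
    rw [pow_two, Perm.mul_apply, hf, hf, Perm.mul_apply]
    by_cases h0 : x = 0
    · subst h0
      rw [swap_apply_left, swap_apply_of_ne_of_ne (by simp) hne]
      simp only [add_zero, inv_one, neg_add_cancel, inv_zero]
      rw [hf' 1 one_ne_zero hne.symm, inv_one]
    by_cases h1 : x = 1
    · subst h1
      rw [swap_apply_of_ne_of_ne one_ne_zero hne.symm, swap_apply_right,
        hf' 1 one_ne_zero hne.symm]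
      simp
    by_cases h2 : x = -1
    · subst h2
      rw [swap_apply_right, swap_apply_left]
      simp
    rw [swap_apply_of_ne_of_ne h0 h2, swap_apply_of_ne_of_ne h0 h1, hf' x h0 h2, hf']
    · simp
    · simpa using h0
    · intro h
      exact h1 (inv_eq_one.mp (neg_inj.mp h))
  rw [h]
  exact Perm.isThreeCycle_swap_mul_swap_same zero_ne_one (by simp) hne.symm

/-- The factor data of the alternating group on a field with `3 mod 4` elements, a prime. -/
def factorDataAlternating (hp : (Fintype.card F).Prime) (hF : Fintype.card F % 4 = 3) :
    FactorData F (alternatingGroup F) where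
  δ := MulAut.conjNormal.comp (MulAction.toPermHom Fˣ F)
  τ := translationHom (Nat.odd_iff.mpr (by omega))
  s := ⟨Equiv.inv F, sign_inv_eq_one hF⟩
  τ_injective b c h := by
    have := congrArg (fun f : alternatingGroup F => (f : Perm F) 0) h
    change b.toAdd + 0 = c.toAdd + 0 at this
    rwa [add_zero, add_zero] at this
  δ_τ a b := by
    ext x
    rw [MonoidHom.comp_apply, MulAut.conjNormal_apply, translationHom_apply]
    change (a : F) * (b + ((a⁻¹ : Fˣ) : F) * x) = a * b + x
    rw [mul_add, Units.mul_inv_cancel_left]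
  s_mul_s := by
    ext x
    exact inv_inv x
  conj_s_δ a t := by
    ext x
    change ((a : F) * (t : Perm F) (((a⁻¹ : Fˣ) : F) * x⁻¹))⁻¹ =
      ((a⁻¹ : Fˣ) : F) * ((t : Perm F) ((((a⁻¹)⁻¹ : Fˣ) : F) * x)⁻¹)⁻¹
    rw [inv_inv, mul_inv, Units.val_inv_eq_inv_val, mul_inv]
  generate K h1 h2 := by
    refine alternatingGroup_subgroup_eq_top (by rwa [Nat.card_eq_fintype_card]) K 0
      (fun x => ⟨_, h1 (.ofAdd x), add_zero x⟩) ?_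
    refine ⟨_, K.pow_mem (K.mul_mem (K.mul_mem (h1 (.ofAdd 1)) (h2 (.ofAdd (-1))))
      (h1 (.ofAdd 1))) 2, ?_⟩
    exact isThreeCycle_of_translation_inv
      (neg_one_ne_one_of_odd_card (Nat.odd_iff.mpr (by omega)))

end Alternating

/-- In an abelian T conjugation by s is trivial, so a = a⁻¹ for a generator a of Fˣ, which forces
|F| ≤ 3. -/
lemma FactorData.exists_mul_ne_mul {F : Type*} [Field F] [Finite F] {T : Type*} [Group T]
    (D : FactorData F T) (hF : 4 ≤ Nat.card F) : ∃ x y : T, x * y ≠ y * x := by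
  by_contra! h
  obtain ⟨a, ha⟩ := IsCyclic.exists_generator (α := Fˣ)
  have hord : orderOf a = Nat.card F - 1 := by
    rw [orderOf_eq_card_of_forall_mem_zpowers ha, Nat.card_units]
  have h1 := D.conj_s_δ a (D.τ (.ofAdd 1))
  rw [h D.s, h D.s, mul_inv_cancel_right, mul_inv_cancel_right, D.δ_τ, D.δ_τ, mul_one, mul_one] at h1
  have h2 : (a : F) = (a⁻¹ : Fˣ) := D.τ_injective h1
  have h3 : a ^ 2 = 1 := by
    rw [pow_two]
    exact mul_eq_one_iff_eq_inv.mpr (Units.ext h2)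
  have h4 := Nat.le_of_dvd two_pos (orderOf_dvd_of_pow_eq_one h3)
  omega

/-! ### Factor data for A₅ over the field with three elements -/

section AlternatingFive

open Equiv

/-- The action of the units of the field with three elements on `A₅` by a double transposition. -/
def alternatingFiveUnits : (ZMod 3)ˣ →* alternatingGroup (Fin 5) where
  -- The exponent is 2 at the unit 1 and 3 at the unit -1.
  toFun a := (⟨swap 0 1 * swap 3 4, Equiv.Perm.mem_alternatingGroup.mpr (by decide)⟩ : alternatingGroup (Fin 5)) ^ ((a : ZMod 3).val + 1)
  map_one' := by decide
  map_mul' := by decide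

/-- A subgroup of order three of `A₅`, parametrized by the field with three elements. -/
def alternatingFiveTranslations : Multiplicative (ZMod 3) →* alternatingGroup (Fin 5) where
  toFun b := (⟨swap 0 1 * swap 1 2, Equiv.Perm.mem_alternatingGroup.mpr (by decide)⟩ : alternatingGroup (Fin 5)) ^ b.toAdd.val
  map_one' := by decide
  map_mul' := by decide

/-- The factor data of `A₅` over the field with three elements. -/
def factorDataAlternatingFive : FactorData (ZMod 3) (alternatingGroup (Fin 5)) where
  δ := MulAut.conj.comp alternatingFiveUnits
  τ := alternatingFiveTranslations
  s := ⟨swap 0 3 * swap 1 4, Equiv.Perm.mem_alternatingGroup.mpr (by decide)⟩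
  τ_injective := by decide
  δ_τ a b := by
    revert a b
    decide
  s_mul_s := by decide
  conj_s_δ a t := by
    have h : ∀ a : (ZMod 3)ˣ, (⟨swap 0 3 * swap 1 4, Equiv.Perm.mem_alternatingGroup.mpr (by decide)⟩ : alternatingGroup (Fin 5)) *
        alternatingFiveUnits a =
        alternatingFiveUnits a⁻¹ * ⟨swap 0 3 * swap 1 4, Equiv.Perm.mem_alternatingGroup.mpr (by decide)⟩ := by decide
    simp only [MonoidHom.comp_apply, MulAut.conj_apply]
    rw [← mul_inv_eq_iff_eq_mul.mpr (h a)]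
    group
  generate K h1 h2 := by
    -- The two subgroups of order three move {0, 1, 2} and {2, 3, 4}; the common point 2 gives
    -- transitivity.
    refine alternatingGroup_subgroup_eq_top (by simpa using Nat.prime_five) K 2 (fun x => ?_) ?_
    · fin_cases x
      · exact ⟨_, h1 (.ofAdd 1), by decide⟩
      · exact ⟨_, h1 (.ofAdd 2), by decide⟩
      · exact ⟨_, h1 (.ofAdd 0), by decide⟩
      · exact ⟨_, h2 (.ofAdd 1), by decide⟩
      · exact ⟨_, h2 (.ofAdd 2), by decide⟩
    · exact ⟨_, h1 (.ofAdd 1), by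
        rw [← card_support_eq_three_iff]
        decide⟩

end AlternatingFive

/-! ### The three families -/

theorem theorem1p2 (q : ℕ) (hq : IsPrimePow q) (hq3 : 3 ≤ q)
    (hdiv : (q + 1).primeFactors.card ≤ 2) (hmod : Even q ∨ (q : ℤ) ≡ -1 [ZMOD 4]) :
    (∃ (T : Type) (_ : Group T), ExistsNonDiagonalPAGraph q T) ∧
    (q ≠ 3 → ∃ (F : Type) (_ : Field F), Nat.card F = q ∧
      ExistsNonDiagonalPAGraph q (Matrix.ProjectiveSpecialLinearGroup (Fin 2) F)) ∧
    (q ≠ 3 → q.Prime → ExistsNonDiagonalPAGraph q (alternatingGroup (Fin q))) := by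
  have hpsl : q ≠ 3 → ∃ (F : Type) (_ : Field F), Nat.card F = q ∧
      ExistsNonDiagonalPAGraph q (Matrix.ProjectiveSpecialLinearGroup (Fin 2) F) := by
    intro hne
    obtain ⟨p, k, hp, hk, rfl⟩ := hq
    have : Fact p.Prime := ⟨hp.nat_prime⟩
    have hcard : Nat.card (GaloisField p k) = p ^ k := GaloisField.card p k hk.ne'
    have := Matrix.ProjectiveSpecialLinearGroup.rank_two_simple (F := GaloisField p k)
      (by omega)
    refine ⟨GaloisField p k, inferInstance, hcard, ?_⟩
    let D := factorDataPSL (F := GaloisField p k)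
    have h := existsNonDiagonalPAGraph_of_factorData
      (D.exists_mul_ne_mul (by omega)) D (by rwa [hcard])
    rwa [hcard] at h
  refine ⟨?_, hpsl, fun hne hqp => ?_⟩
  · by_cases hne : q = 3
    -- PSL₂(3) is not simple, so A₅ serves as the factor here.
    · subst hne
      have := alternatingGroup.isSimpleGroup (α := Fin 5) (by simp)
      have h := existsNonDiagonalPAGraph_of_factorData ?_ factorDataAlternatingFive
        (by rw [Nat.card_zmod]; exact hmod)
      · rw [Nat.card_zmod] at h
        exact ⟨_, _, h⟩
      · exact ⟨⟨Equiv.swap 0 1 * Equiv.swap 1 2, Equiv.Perm.mem_alternatingGroup.mpr (by decide)⟩,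
          ⟨Equiv.swap 0 3 * Equiv.swap 1 4, Equiv.Perm.mem_alternatingGroup.mpr (by decide)⟩, by decide⟩
    · obtain ⟨F, _, -, h⟩ := hpsl hne
      exact ⟨_, _, h⟩
  · have : Fact q.Prime := ⟨hqp⟩
    have hodd := hqp.eq_two_or_odd.resolve_left (by omega)
    have hq4 : q % 4 = 3 := by
      rcases hmod with h | h
      · rw [Nat.even_iff] at h; omega
      · have := h.dvd; omega
    have hcard : Fintype.card (ZMod q) = q := ZMod.card q
    have := alternatingGroup.isSimpleGroup (α := Fin q) (by simp; omega)
    let D : FactorData (ZMod q) (alternatingGroup (Fin q)) :=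
      (factorDataAlternating (by rwa [hcard]) (by rwa [hcard])).congr
        (Equiv.altCongrHom (ZMod.finEquiv q).symm.toEquiv)
    have hcard' : Nat.card (ZMod q) = q := Nat.card_zmod q
    have h := existsNonDiagonalPAGraph_of_factorData
      (D.exists_mul_ne_mul (by omega)) D (by rwa [hcard'])
    rwa [hcard'] at h
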